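/- Let $\Phi=\{\phi_i\}_{i\in\mathcal D}$ ($\mathcal D$ finite) be a conformal iterated function system on a compact set $Y\subset\mathbb R^d$: each $\phi_i$ maps $Y$ into $Y$ and extends to an injective $C^1$ contraction (with respect to the Euclidean norm) on a common open connected neighbourhood $V\supset Y$, such that for each $i$: $|\phi_i'(x)y|=|\phi_i'(x)||y|$ for all $x\in V$, $y\in\mathbb R^d$; $0<\inf_{V}|\phi_i'|\le\sup_V|\phi_i'|<1$; and $\big||\phi_i'(x)|-|\phi_i'(y)|\big|\le c|x-y|^\alpha$ on $V$ for some $c,\alpha>0$. Let $X\subset Y$ be its attractor, i.e. the unique non-empty compact subset of $Y$ with $X=\bigcup_i\phi_i(X)$, and assume $\dim_H X>0$. For $I=(i_1,\dots,i_n)\in\mathcal D^n$ put $\phi_I=\phi_{i_1}\circ\cdots\circ\phi_{i_n}$, $X_I=\phi_I(X)$, $|I|=n$; let $\mathcal D^*=\bigcup_{n\ge1}\mathcal D^n$. The similarity dimension $\dim_S X$ (which depends on $\Phi$) is the unique $s\in\mathbb R$ with $P(s)=0$, where $$P(s)=\lim_{n\to\infty}\tfrac1n\log\inf_{x\in X}\sum_{I\in\mathcal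 D^n}|\phi_I'(x)|^s=\lim_{n\to\infty}\tfrac1n\log\sup_{x\in X}\sum_{I\in\mathcal D^n}|\phi_I'(x)|^s .$$ For $\theta:\mathbb N\to[0,\infty)$ put $\Psi_\theta(I)=\mathrm{Diam}(X_I)^{\dim_S X/\dim_H X}\,\theta(|I|)$, and for $z\in X$ let $W(\Psi_\theta,z)$ be the set of $x\in X$ with $|x-\phi_I(z)|\le\Psi_\theta(I)$ for infinitely many $I\in\mathcal D^*$. Given $z\in X$, the pair $(\Phi,z)$ is called approximation regular if for every non-increasing $\theta:\mathbb N\to[0,\infty)$ with $$\sum_{n=1}^\infty\sum_{I\in\mathcal D^n}\Psi_\theta(I)^{\dim_H X}=\infty\qquad(*)$$ the following holds: $\mathcal H^{\dim_H X}$-almost every $x\in X$ lies in $W(\Psi_\theta,z)$, if $\mathcal H^{\dim_H X}(X)>0$; and $\dim_H W(\Psi_\theta,z)=\dim_H X$, if $\mathcal H^{\dim_H X}(X)=0$. **Theorem.** Suppose that $\Phi$ contains an exact overlap, i.e. there are $n$ and distinct $I,J\in\mathcal D^n$ with $\phi_I=\phi_J$ on $Y$. Then the similarity dimension is well defined (there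 is exactly one $s$ for which both limits defining $P(s)$ exist and equal $0$), and $(\Phi,z)$ is not approximation regular for any $z\in X$. Moreover, for $\theta\equiv1$ the divergence condition $(*)$ holds, whereas $\dim_H W(\Psi_\theta,z)<\dim_H X$ for every $z\in X$. -/

import Mathlib

open Set Filter Topology MeasureTheory
open scoped NNReal ENNReal

namespace ConformalIFS

noncomputable section

/-- The ambient Euclidean space `ℝ^d`. -/
abbrev E (d : ℕ) := EuclideanSpace ℝ (Fin d)

/-- The composition `φ_I = φ_{i₁} ∘ ⋯ ∘ φ_{iₙ}` along the finite word `I = (i₁, …, iₙ)`. -/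
def wordMap {d : ℕ} {ι : Type*} (Φ : ι → E d → E d) : List ι → E d → E d
  | [] => id
  | i :: I => Φ i ∘ wordMap Φ I

/-- `Φ = {φ_i}` is a conformal iterated function system on the compact set `Y`.
Each `Φ i` stands for the extension of `φ_i` to the open connected neighbourhood `V` of `Y`;
the values of `Φ i` outside `V` are irrelevant. -/
structure IsConformalIFS {d : ℕ} {ι : Type*} (Φ : ι → E d → E d) (Y : Set (E d)) : Prop where
  isCompact : IsCompact Y
  mapsTo : ∀ i, MapsTo (Φ i) Y Y
  exists_nhd : ∃ V : Set (E d), IsOpen V ∧ IsConnected V ∧ Y ⊆ V ∧ ∀ i,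
    -- an injective `C¹` contraction on `V`
    InjOn (Φ i) V ∧ ContDiffOn ℝ 1 (Φ i) V ∧
    (∃ r : ℝ, 0 < r ∧ r < 1 ∧ ∀ x ∈ V, ∀ y ∈ V, ‖Φ i x - Φ i y‖ ≤ r * ‖x - y‖) ∧
    -- conformality
    (∀ x ∈ V, ∀ y, ‖fderiv ℝ (Φ i) x y‖ = ‖fderiv ℝ (Φ i) x‖ * ‖y‖) ∧
    -- the norm of the differential is bounded away from `0` and from `1` on `V`
    (∃ a : ℝ, 0 < a ∧ ∀ x ∈ V, a ≤ ‖fderiv ℝ (Φ i) x‖) ∧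
    (∃ b : ℝ, b < 1 ∧ ∀ x ∈ V, ‖fderiv ℝ (Φ i) x‖ ≤ b) ∧
    -- Hölder continuity of the differential
    (∃ α : ℝ, 0 < α ∧ ∃ c : ℝ, 0 < c ∧ ∀ x ∈ V, ∀ y ∈ V,
      |‖fderiv ℝ (Φ i) x‖ - ‖fderiv ℝ (Φ i) y‖| ≤ c * ‖x - y‖ ^ α)

/-- `X` is the attractor of the system `Φ` on `Y`: a non-empty compact set with
`X = ⋃ i, φ_i(X)`. -/
structure IsAttractor {d : ℕ} {ι : Type*} (Φ : ι → E d → E d) (Y X : Set (E d)) : Prop where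
  nonempty : X.Nonempty
  isCompact : IsCompact X
  subset : X ⊆ Y
  eq_iUnion : X = ⋃ i, Φ i '' X

/-- `φ_I = φ_J` on `Y` for two distinct words `I`, `J` of the same length. -/
def HasExactOverlap {d : ℕ} {ι : Type*} (Φ : ι → E d → E d) (Y : Set (E d)) : Prop :=
  ∃ I J : List ι, I.length = J.length ∧ I ≠ J ∧ EqOn (wordMap Φ I) (wordMap Φ J) Y

/-- `∑_{|I| = n} |φ_I'(x)|^s`. -/
def derivSum {d : ℕ} {ι : Type*} [Fintype ι] (Φ : ι → E d → E d) (s : ℝ) (n : ℕ) (x : E d) : ℝ :=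
  ∑ I : Fin n → ι, ‖fderiv ℝ (wordMap Φ (List.ofFn I)) x‖ ^ s

/-- The pressure `P(s)` exists and equals `p`:
`p = lim (1/n) log inf_{x ∈ X} ∑_{|I| = n} |φ_I'(x)|^s
   = lim (1/n) log sup_{x ∈ X} ∑_{|I| = n} |φ_I'(x)|^s`. -/
def HasPressure {d : ℕ} {ι : Type*} [Fintype ι] (Φ : ι → E d → E d) (X : Set (E d))
    (s p : ℝ) : Prop :=
  Tendsto (fun n : ℕ => (1 / (n : ℝ)) * Real.log (⨅ x : X, derivSum Φ s n x)) atTop (𝓝 p) ∧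
  Tendsto (fun n : ℕ => (1 / (n : ℝ)) * Real.log (⨆ x : X, derivSum Φ s n x)) atTop (𝓝 p)

/-- The similarity dimension: the `s` with `P(s) = 0`. (The infimum is over a set which has
exactly one element whenever the similarity dimension is well defined.) -/
def simDim {d : ℕ} {ι : Type*} [Fintype ι] (Φ : ι → E d → E d) (X : Set (E d)) : ℝ :=
  sInf {s : ℝ | HasPressure Φ X s 0}

/-- The limsup set `W(Ψ, z)`: the points of `X` which lie in the ball `B(φ_I(z), Ψ(I))` for
infinitely many finite words `I` of positive length. -/
def limsupSet {d : ℕ} {ι : Type*} (Φ : ι → E d → E d) (X : Set (E d)) (Ψ : List ι → ℝ)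
    (z : E d) : Set (E d) :=
  {x ∈ X | {I : List ι | I ≠ [] ∧ x ∈ Metric.closedBall (wordMap Φ I z) (Ψ I)}.Infinite}

/-- The Hausdorff dimension as a real number (it is at most `d`). -/
def hdim {d : ℕ} (X : Set (E d)) : ℝ := (dimH X).toReal

/-- The approximating function `Ψ(I) = Diam(X_I)^{dim_S(X) / dim_H(X)} θ(|I|)`. -/
def approxFun {d : ℕ} {ι : Type*} [Fintype ι] (Φ : ι → E d → E d) (X : Set (E d))
    (θ : ℕ → ℝ≥0) (I : List ι) : ℝ :=
  Metric.diam (wordMap Φ I '' X) ^ (simDim Φ X / hdim X) * θ I.length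

/-- The divergence condition `∑_{n ≥ 1} ∑_{|I| = n} Ψ(I)^{dim_H(X)} = ∞` for the
approximating function `Ψ` associated with `θ`. -/
def Diverges {d : ℕ} {ι : Type*} [Fintype ι] (Φ : ι → E d → E d) (X : Set (E d))
    (θ : ℕ → ℝ≥0) : Prop :=
  ∑' n : ℕ, ∑ I : Fin (n + 1) → ι,
    ENNReal.ofReal (approxFun Φ X θ (List.ofFn I) ^ hdim X) = ⊤

/-- `(Φ, z)` is an approximation regular pair (`X` being the attractor of `Φ`). -/
def IsApproxRegularPair {d : ℕ} {ι : Type*} [Fintype ι] (Φ : ι → E d → E d) (X : Set (E d))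
    (z : E d) : Prop :=
  z ∈ X ∧
  (0 < Measure.hausdorffMeasure (hdim X) X →
    ∀ θ : ℕ → ℝ≥0, AntitoneOn θ (Ici 1) → Diverges Φ X θ →
      ∀ᵐ x ∂((Measure.hausdorffMeasure (hdim X)).restrict X),
        x ∈ limsupSet Φ X (approxFun Φ X θ) z) ∧
  (Measure.hausdorffMeasure (hdim X) X = 0 →
    ∀ θ : ℕ → ℝ≥0, AntitoneOn θ (Ici 1) → Diverges Φ X θ →
      dimH (limsupSet Φ X (approxFun Φ X θ) z) = dimH X)

end

end ConformalIFS

/-! Write `Z_n(s)` for the sum of the `s`-th powers of the derivative norms over words of length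
`n`. Conformality makes these norms an exact multiplicative cocycle. Hölder continuity and
contraction give bounded distortion with a constant `K` that does not depend on the word. Hence
`Z_n` is both sub- and supermultiplicative up to `K ^ |s|`. Fekete's lemma gives the pressure, and
its slopes lie between `log a < 0` and `log b < 0`, so it has exactly one zero `s`. At this zero,
`Z_n(s)` lies between two positive constants. Since `Ψ(I) ^ dim_H` is `diam(X_I) ^ s` when `θ ≡ 1`,
and hence comparable to the weight to the power `s`, every level contributes at least a fixed amount
and the series diverges.

An exact overlap makes a block `J` of length `N` replaceable by another block. Every `φ_I` is
therefore also the map of a word of the same length whose blocks avoid `J`, followed by fewer than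
`N` letters (`exists_flatMap_append_eqOn`), and the limsup set is covered by balls indexed by these
words alone. Omitting a block strictly lowers the critical exponent
(`exists_lt_sum_range_removeBlock_le`): a renewal inequality shows that the `J`-free sums are
summable at `s`, so they become small at some level, and continuity yields boundedness of the whole
series at some `τ < s`. With radii `diam ^ (s / dim_H)`, the cover has a bounded sum of powers at
the exponent `τ * dim_H / s < dim_H`. A set of smaller dimension is null for `ℋ ^ dim_H`, which
refutes regularity in both cases of its definition. -/

namespace ConformalIFS

/-! ### Distortion estimates for a single conformal map -/

/-- If the derivative of an injective map expands by at least `m` on `ball x R`, then points at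
distance at least `R` from `x` have images at distance at least `m * R` from the image of `x`. -/
theorem mul_le_norm_image_sub_of_injOn {F : Type*} [NormedAddCommGroup F] [NormedSpace ℝ F]
    [FiniteDimensional ℝ F] {f : F → F} {U : Set F} {x y : F} {m R : ℝ}
    (hf : InjOn f U) (hU : Metric.ball x R ⊆ U)
    (hd : ∀ u ∈ Metric.ball x R, DifferentiableAt ℝ f u)
    (hm : 0 < m) (hR : 0 < R) (hexp : ∀ u ∈ Metric.ball x R, ∀ v, m * ‖v‖ ≤ ‖fderiv ℝ f u v‖)
    (hy : y ∈ U) (hxy : R ≤ ‖x - y‖) : m * R ≤ ‖f x - f y‖ := by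
  by_contra! hlt
  have h1 : ∃ q : ℝ, 0 < q ∧ q < 1 ∧ ‖f x - f y‖ < (m * q) * (R * q) := by
    have hc : Tendsto (fun q : ℝ => (m * q) * (R * q)) (𝓝[<] 1) (𝓝 ((m * 1) * (R * 1))) :=
      (Continuous.tendsto (by fun_prop) 1).mono_left nhdsWithin_le_nhds
    have h2 := hc.eventually_const_lt (show ‖f x - f y‖ < m * 1 * (R * 1) by simpa using hlt)
    have h3 : ∀ᶠ q : ℝ in 𝓝[<] 1, q ∈ Ioo (0 : ℝ) 1 := Ioo_mem_nhdsLT one_pos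
    obtain ⟨q, hq, hq'⟩ := (h2.and h3).exists
    exact ⟨q, hq'.1, hq'.2, hq⟩
  obtain ⟨q, hq0, hq1, hq⟩ := h1
  have hR' : 0 < R * q := by positivity
  have hRR : R * q < R := by nlinarith
  have hsub : Metric.closedBall x (R * q) ⊆ Metric.ball x R := Metric.closedBall_subset_ball hRR
  -- The distance to `f y` is minimised with a penalty of slope `m * q`. As `q < 1`, moving the
  -- image towards `f y` gains more than the penalty costs, so no minimiser can be interior.
  have hcont : ContinuousOn (fun u => ‖f u - f y‖ + m * q * ‖u - x‖)
      (Metric.closedBall x (R * q)) := by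
    have : ContinuousOn f (Metric.closedBall x (R * q)) := fun u hu =>
      (hd u (hsub hu)).continuousAt.continuousWithinAt
    fun_prop
  obtain ⟨u, hu, hmin⟩ := (isCompact_closedBall x (R * q)).exists_isMinOn
    ⟨x, Metric.mem_closedBall_self hR'.le⟩ hcont
  -- Interior because the value at the centre `x` is already below the penalty on the boundary
  -- sphere.
  have hux : ‖u - x‖ < R * q := by
    have h2 := hmin (Metric.mem_closedBall_self hR'.le)
    simp only [mem_ofPred_eq, sub_self, norm_zero, mul_zero, add_zero] at h2
    have h3 : m * q * ‖u - x‖ < m * q * (R * q) := by linarith [norm_nonneg (f u - f y)]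
    exact lt_of_mul_lt_mul_left h3 (by positivity)
  have huB := hsub hu
  have hne : f u ≠ f y := by
    intro h
    have := hf (hU huB) hy h
    subst this
    rw [norm_sub_rev] at hux
    linarith
  have hN : 0 < ‖f u - f y‖ := norm_pos_iff.2 (sub_ne_zero.2 hne)
  have hinj : Function.Injective (fderiv ℝ f u : F →ₗ[ℝ] F) := by
    rw [← LinearMap.ker_eq_bot, LinearMap.ker_eq_bot']
    intro v hv
    have h2 := hexp u huB v
    rw [ContinuousLinearMap.coe_coe] at hv
    rw [hv, norm_zero] at h2
    exact norm_le_zero_iff.1 (by nlinarith [norm_nonneg v])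
  -- The direction `v` moves the image straight towards `f y`; the expansion bound controls its
  -- length.
  obtain ⟨v, hv⟩ := (LinearMap.injective_iff_surjective.1 hinj) (f y - f u)
  rw [ContinuousLinearMap.coe_coe] at hv
  have hvN : m * ‖v‖ ≤ ‖f u - f y‖ := by
    have := hexp u huB v
    rwa [hv, norm_sub_rev] at this
  have hline : HasDerivAt (fun t : ℝ => f (u + t • v)) (f y - f u) 0 := by
    have h2 : HasFDerivAt f (fderiv ℝ f u) (u + (0 : ℝ) • v) := by
      simpa using (hd u huB).hasFDerivAt
    have h3 : HasDerivAt (fun t : ℝ => u + t • v) v 0 := by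
      simpa using ((hasDerivAt_id (0 : ℝ)).smul_const v).const_add u
    have h4 := h2.comp_hasDerivAt (0 : ℝ) h3
    rwa [hv] at h4
  have hη : 0 < (1 - q) * ‖f u - f y‖ / 2 := by
    have : 0 < 1 - q := by linarith
    positivity
  have h5 := (hasDerivAt_iff_isLittleO.1 hline).def hη
  have h6 : ∀ᶠ t : ℝ in 𝓝[>] 0, t ∈ Ioo (0 : ℝ) 1 := Ioo_mem_nhdsGT one_pos
  have h7 : ∀ᶠ t : ℝ in 𝓝 0, u + t • v ∈ Metric.closedBall x (R * q) := by
    have hc : Tendsto (fun t : ℝ => u + t • v) (𝓝 0) (𝓝 u) := by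
      have : Tendsto (fun t : ℝ => u + t • v) (𝓝 0) (𝓝 (u + (0 : ℝ) • v)) :=
        Continuous.tendsto (by fun_prop) 0
      simpa using this
    refine hc (Filter.mem_of_superset (Metric.isOpen_ball.mem_nhds ?_) Metric.ball_subset_closedBall)
    rwa [mem_ball_iff_norm]
  obtain ⟨t, ⟨ht5, ht7⟩, ht0, ht1⟩ :=
    (((h5.and h7).filter_mono (nhdsWithin_le_nhds (s := Ioi 0))).and h6).exists
  have h8 := hmin ht7
  simp only [mem_ofPred_eq] at h8
  simp only [sub_zero, zero_smul, add_zero, Real.norm_eq_abs, abs_of_pos ht0] at ht5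
  have h9 : ‖f (u + t • v) - f y‖ ≤ (1 - t) * ‖f u - f y‖ + (1 - q) * ‖f u - f y‖ / 2 * t := by
    have : f (u + t • v) - f y
        = (1 - t) • (f u - f y) + (f (u + t • v) - f u - t • (f y - f u)) := by
      module
    rw [this]
    refine (norm_add_le _ _).trans (add_le_add ?_ ht5)
    rw [norm_smul, Real.norm_eq_abs, abs_of_nonneg (by linarith)]
  have h10 : ‖u + t • v - x‖ ≤ ‖u - x‖ + t * ‖v‖ := by
    have : u + t • v - x = (u - x) + t • v := by abel
    rw [this]
    refine (norm_add_le _ _).trans ?_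
    rw [norm_smul, Real.norm_eq_abs, abs_of_pos ht0]
  have h11 : m * q * ‖u + t • v - x‖ ≤ m * q * ‖u - x‖ + q * t * ‖f u - f y‖ := by
    have := mul_le_mul_of_nonneg_left h10 (show 0 ≤ m * q by positivity)
    have h12 := mul_le_mul_of_nonneg_left hvN (show 0 ≤ q * t by positivity)
    nlinarith
  have h13 : 0 < (1 - q) * ‖f u - f y‖ / 2 * t := by positivity
  nlinarith

/-- The basic estimates for a single conformal map on a compact set: Hölder control of the
distortion, and comparison of difference quotients with the norm of the differential. -/
theorem exists_holder_distortion {F : Type*} [NormedAddCommGroup F] [NormedSpace ℝ F]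
    [FiniteDimensional ℝ F] {f : F → F} {V Y : Set F} (hY : IsCompact Y) (hV : IsOpen V)
    (hYV : Y ⊆ V) (hinj : InjOn f V) (hdiff : ∀ x ∈ V, DifferentiableAt ℝ f x)
    (hlip : ∀ x ∈ V, ∀ y ∈ V, ‖f x - f y‖ ≤ ‖x - y‖)
    (hconf : ∀ x ∈ V, ∀ y, ‖fderiv ℝ f x y‖ = ‖fderiv ℝ f x‖ * ‖y‖)
    {a : ℝ} (ha : 0 < a) (hga : ∀ x ∈ V, a ≤ ‖fderiv ℝ f x‖)
    (hgb : ∀ x ∈ V, ‖fderiv ℝ f x‖ ≤ 1)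
    {α c : ℝ} (hα : 0 < α) (hc : 0 < c) (hhol : ∀ x ∈ V, ∀ y ∈ V,
      |‖fderiv ℝ f x‖ - ‖fderiv ℝ f y‖| ≤ c * ‖x - y‖ ^ α) :
    ∃ C : ℝ, 0 ≤ C ∧ ∀ x ∈ Y, ∀ y ∈ Y,
      ‖fderiv ℝ f x‖ ≤ ‖fderiv ℝ f y‖ * Real.exp (C * ‖x - y‖ ^ α) ∧
      ‖f x - f y‖ ≤ ‖fderiv ℝ f x‖ * ‖x - y‖ * Real.exp (C * ‖x - y‖ ^ α) ∧
      ‖fderiv ℝ f x‖ * ‖x - y‖ ≤ ‖f x - f y‖ * Real.exp (C * ‖x - y‖ ^ α) := by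
  obtain ⟨ε₀, hε₀, hthick⟩ := hY.exists_thickening_subset_open hV hYV
  obtain ⟨ε, hε, hεε, hεc⟩ : ∃ ε > 0, ε ≤ ε₀ ∧ c / a * ε ^ α ≤ 1 / 2 := by
    refine ⟨min ε₀ ((a / (2 * c)) ^ α⁻¹), by positivity, min_le_left _ _, ?_⟩
    have h1 : (min ε₀ ((a / (2 * c)) ^ α⁻¹)) ^ α ≤ a / (2 * c) := by
      calc _ ≤ ((a / (2 * c)) ^ α⁻¹) ^ α := by
            gcongr
            exact min_le_right _ _
        _ = a / (2 * c) := by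
            rw [← Real.rpow_mul (by positivity), inv_mul_cancel₀ hα.ne', Real.rpow_one]
    calc _ ≤ c / a * (a / (2 * c)) := by gcongr
      _ = 1 / 2 := by field_simp
  have hball : ∀ x ∈ Y, Metric.ball x ε ⊆ V := fun x hx =>
    (Metric.ball_subset_ball hεε).trans ((Metric.ball_subset_thickening hx _).trans hthick)
  obtain ⟨D, hD⟩ : ∃ D : ℝ, ∀ x ∈ Y, ∀ y ∈ Y, ‖x - y‖ ≤ D := by
    obtain ⟨D, hD⟩ := Metric.isBounded_iff.1 hY.isBounded
    exact ⟨D, fun x hx y hy => by simpa [dist_eq_norm] using hD hx hy⟩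
  have hεα : 0 < ε ^ α := by positivity
  -- One summand for each regime: pairs closer than `ε`, far pairs in the upper bound, and far pairs
  -- in the lower bound. `Y` need not be convex, so the local arguments on balls serve only near
  -- pairs; for far pairs the factor `exp (C * ε ^ α)` absorbs everything.
  set C := 2 * c / a + 1 / (a * ε ^ α) + |D| / (a * ε * ε ^ α) with hC
  have hC1 : 2 * (c / a) ≤ C := by
    have : 0 ≤ 1 / (a * ε ^ α) + |D| / (a * ε * ε ^ α) := by positivity
    rw [hC, mul_div_assoc]; linarith
  have hC2 : 1 / (a * ε ^ α) ≤ C := by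
    have : 0 ≤ 2 * c / a + |D| / (a * ε * ε ^ α) := by positivity
    rw [hC]; linarith
  have hC3 : |D| / (a * ε * ε ^ α) ≤ C := by
    have : 0 ≤ 2 * c / a + 1 / (a * ε ^ α) := by positivity
    rw [hC]; linarith
  have hC0 : 0 ≤ C := by positivity
  have hca : 0 < c / a := by positivity
  have hexp : ∀ t : ℝ, 0 ≤ t → 1 + c / a * t ≤ Real.exp (C * t) := fun t ht => by
    refine le_trans ?_ (Real.add_one_le_exp _)
    nlinarith
  refine ⟨C, hC0, fun x hx y hy => ⟨?_, ?_, ?_⟩⟩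
  · have hay := hga y (hYV hy)
    have h1 := (abs_le.1 (hhol x (hYV hx) y (hYV hy))).2
    have ht : 0 ≤ ‖x - y‖ ^ α := by positivity
    calc ‖fderiv ℝ f x‖ ≤ ‖fderiv ℝ f y‖ + a * (c / a * ‖x - y‖ ^ α) := by
          have : a * (c / a * ‖x - y‖ ^ α) = c * ‖x - y‖ ^ α := by field_simp
          linarith
      _ ≤ ‖fderiv ℝ f y‖ + ‖fderiv ℝ f y‖ * (c / a * ‖x - y‖ ^ α) := by gcongr
      _ = ‖fderiv ℝ f y‖ * (1 + c / a * ‖x - y‖ ^ α) := by ring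
      _ ≤ _ := by
          gcongr
          exact hexp _ ht
  · have hax := hga x (hYV hx)
    rcases lt_or_ge ‖x - y‖ ε with hlt | hge
    · have hsub : Metric.closedBall x ‖x - y‖ ⊆ V :=
        (Metric.closedBall_subset_ball hlt).trans (hball x hx)
      have hbd : ∀ u ∈ Metric.closedBall x ‖x - y‖,
          ‖fderiv ℝ f u‖ ≤ ‖fderiv ℝ f x‖ * Real.exp (C * ‖x - y‖ ^ α) := by
        intro u hu
        have h1 := (abs_le.1 (hhol u (hsub hu) x (hYV hx))).2
        have h2 : ‖u - x‖ ^ α ≤ ‖x - y‖ ^ α := by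
          gcongr
          exact mem_closedBall_iff_norm.1 hu
        calc ‖fderiv ℝ f u‖ ≤ ‖fderiv ℝ f x‖ + a * (c / a * ‖x - y‖ ^ α) := by
              have : a * (c / a * ‖x - y‖ ^ α) = c * ‖x - y‖ ^ α := by field_simp
              nlinarith
          _ ≤ ‖fderiv ℝ f x‖ + ‖fderiv ℝ f x‖ * (c / a * ‖x - y‖ ^ α) := by gcongr
          _ = ‖fderiv ℝ f x‖ * (1 + c / a * ‖x - y‖ ^ α) := by ring
          _ ≤ _ := by
              gcongr
              exact hexp _ (by positivity)
      have := (convex_closedBall x ‖x - y‖).norm_image_sub_le_of_norm_fderiv_le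
        (fun u hu => hdiff u (hsub hu)) hbd
        (mem_closedBall_iff_norm.2 (norm_sub_rev y x).le)
        (Metric.mem_closedBall_self (norm_nonneg _))
      linarith
    · have h1 : 1 ≤ ‖fderiv ℝ f x‖ * Real.exp (C * ‖x - y‖ ^ α) := by
        have h2 : ε ^ α ≤ ‖x - y‖ ^ α := by gcongr
        calc (1 : ℝ) = a * (1 / (a * ε ^ α) * ε ^ α) := by field_simp
          _ ≤ ‖fderiv ℝ f x‖ * (C * ‖x - y‖ ^ α) := by gcongr
          _ ≤ _ := by
              gcongr
              linarith [Real.add_one_le_exp (C * ‖x - y‖ ^ α)]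
      have h3 := hlip x (hYV hx) y (hYV hy)
      nlinarith [norm_nonneg (x - y)]
  · have hax := hga x (hYV hx)
    have hbx := hgb x (hYV hx)
    rcases eq_or_ne x y with rfl | hne
    · simp
    have hpos : 0 < ‖x - y‖ := norm_pos_iff.2 (sub_ne_zero.2 hne)
    rcases lt_or_ge ‖x - y‖ ε with hlt | hge
    · have hsub : Metric.ball x ‖x - y‖ ⊆ V :=
        (Metric.ball_subset_ball hlt.le).trans (hball x hx)
      set t := c / a * ‖x - y‖ ^ α with ht
      have ht0 : 0 ≤ t := by positivity
      have ht1 : t ≤ 1 / 2 := by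
        refine le_trans ?_ hεc
        rw [ht]
        gcongr
      have hbd : ∀ u ∈ Metric.ball x ‖x - y‖, ∀ v,
          ‖fderiv ℝ f x‖ * (1 - t) * ‖v‖ ≤ ‖fderiv ℝ f u v‖ := by
        intro u hu v
        rw [hconf u (hsub hu)]
        have h1 := (abs_le.1 (hhol u (hsub hu) x (hYV hx))).1
        have h2 : ‖u - x‖ ^ α ≤ ‖x - y‖ ^ α := by
          gcongr
          exact (mem_ball_iff_norm.1 hu).le
        have h3 : a * t = c * ‖x - y‖ ^ α := by rw [ht]; field_simp
        gcongr
        nlinarith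
      have key := mul_le_norm_image_sub_of_injOn hinj hsub (fun u hu => hdiff u (hsub hu))
        (mul_pos (ha.trans_le hax) (by linarith : 0 < 1 - t)) hpos hbd (hYV hy) le_rfl
      have h4 : 1 ≤ (1 - t) * Real.exp (C * ‖x - y‖ ^ α) := by
        have h5 : 2 * t ≤ C * ‖x - y‖ ^ α := by
          rw [ht, ← mul_assoc]
          gcongr
        have h6 := Real.add_one_le_exp (C * ‖x - y‖ ^ α)
        nlinarith
      calc ‖fderiv ℝ f x‖ * ‖x - y‖ = ‖fderiv ℝ f x‖ * ‖x - y‖ * 1 := by ring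
        _ ≤ ‖fderiv ℝ f x‖ * ‖x - y‖ * ((1 - t) * Real.exp (C * ‖x - y‖ ^ α)) := by gcongr
        _ = ‖fderiv ℝ f x‖ * (1 - t) * ‖x - y‖ * Real.exp (C * ‖x - y‖ ^ α) := by ring
        _ ≤ _ := by gcongr
    · have key := mul_le_norm_image_sub_of_injOn hinj (hball x hx)
        (fun u hu => hdiff u (hball x hx hu)) ha hε
        (fun u hu v => by
          rw [hconf u (hball x hx hu)]
          exact mul_le_mul_of_nonneg_right (hga u (hball x hx hu)) (norm_nonneg v))
        (hYV hy) hge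
      have h2 : ε ^ α ≤ ‖x - y‖ ^ α := by gcongr
      calc ‖fderiv ℝ f x‖ * ‖x - y‖ ≤ 1 * |D| := by
            gcongr
            exact (hD x hx y hy).trans (le_abs_self _)
        _ = a * ε * (|D| / (a * ε * ε ^ α) * ε ^ α) := by field_simp
        _ ≤ a * ε * (C * ‖x - y‖ ^ α) := by gcongr
        _ ≤ ‖f x - f y‖ * Real.exp (C * ‖x - y‖ ^ α) := by
            gcongr
            linarith [Real.add_one_le_exp (C * ‖x - y‖ ^ α)]

/-! ### Bounded distortion along words -/

section Words

variable {d : ℕ} {ι : Type*} {Φ : ι → E d → E d} {Y : Set (E d)}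

theorem wordMap_append (Φ : ι → E d → E d) (I J : List ι) (x : E d) :
    wordMap Φ (I ++ J) x = wordMap Φ I (wordMap Φ J x) := by
  induction I with
  | nil => rfl
  | cons i I ih => simp only [List.cons_append, wordMap, Function.comp_apply, ih]

theorem mapsTo_wordMap (h : ∀ i, MapsTo (Φ i) Y Y) (I : List ι) : MapsTo (wordMap Φ I) Y Y := by
  induction I with
  | nil => exact mapsTo_id Y
  | cons i I ih => exact (h i).comp ih

/-- Only the outer factor has to be a similarity. This turns the chain rule into an equality of
norms. -/
theorem norm_comp_eq_of_conformal {F : Type*} [NormedAddCommGroup F] [NormedSpace ℝ F]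
    {A B : F →L[ℝ] F} (hA : ∀ v, ‖A v‖ = ‖A‖ * ‖v‖) (h0 : 0 < ‖A‖) :
    ‖A.comp B‖ = ‖A‖ * ‖B‖ := by
  refine le_antisymm (A.opNorm_comp_le B) ?_
  rw [← le_div_iff₀' h0]
  refine B.opNorm_le_bound (by positivity) fun v => ?_
  have := (A.comp B).le_opNorm v
  rw [ContinuousLinearMap.comp_apply, hA] at this
  rw [div_mul_eq_mul_div, le_div_iff₀' h0]
  exact this

theorem differentiableAt_wordMap (h : ∀ i, MapsTo (Φ i) Y Y)
    (hd : ∀ i, ∀ x ∈ Y, DifferentiableAt ℝ (Φ i) x) (I : List ι) {x : E d} (hx : x ∈ Y) :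
    DifferentiableAt ℝ (wordMap Φ I) x := by
  induction I with
  | nil => exact differentiableAt_id
  | cons i I ih => exact (hd i _ (mapsTo_wordMap h I hx)).comp x ih

theorem norm_fderiv_wordMap_cons (h : ∀ i, MapsTo (Φ i) Y Y)
    (hd : ∀ i, ∀ x ∈ Y, DifferentiableAt ℝ (Φ i) x)
    (hconf : ∀ i, ∀ x ∈ Y, ∀ v, ‖fderiv ℝ (Φ i) x v‖ = ‖fderiv ℝ (Φ i) x‖ * ‖v‖)
    (hpos : ∀ i, ∀ x ∈ Y, 0 < ‖fderiv ℝ (Φ i) x‖) (i : ι) (I : List ι) {x : E d} (hx : x ∈ Y) :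
    ‖fderiv ℝ (wordMap Φ (i :: I)) x‖
      = ‖fderiv ℝ (Φ i) (wordMap Φ I x)‖ * ‖fderiv ℝ (wordMap Φ I) x‖ := by
  have hIx := mapsTo_wordMap h I hx
  rw [wordMap, fderiv_comp x (hd i _ hIx) (differentiableAt_wordMap h hd I hx)]
  exact norm_comp_eq_of_conformal (hconf i _ hIx) (hpos i _ hIx)

theorem norm_fderiv_wordMap_nil [Nontrivial (E d)] (x : E d) :
    ‖fderiv ℝ (wordMap Φ []) x‖ = 1 := by
  rw [wordMap, fderiv_id]
  exact ContinuousLinearMap.norm_id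

/-- Along words, the norm of the differential is a multiplicative cocycle with bounded distortion,
comparable to all difference quotients. -/
theorem IsConformalIFS.exists_bounds [Finite ι] [Nontrivial (E d)] (hΦ : IsConformalIFS Φ Y) :
    (∀ I J : List ι, ∀ x ∈ Y, ‖fderiv ℝ (wordMap Φ (I ++ J)) x‖
      = ‖fderiv ℝ (wordMap Φ I) (wordMap Φ J x)‖ * ‖fderiv ℝ (wordMap Φ J) x‖) ∧
    ∃ K a b : ℝ, 1 ≤ K ∧ 0 < a ∧ a < 1 ∧ 0 < b ∧ b < 1 ∧ ∀ I : List ι, ∀ x ∈ Y,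
      a ^ I.length ≤ ‖fderiv ℝ (wordMap Φ I) x‖ ∧ ‖fderiv ℝ (wordMap Φ I) x‖ ≤ b ^ I.length ∧
      ∀ y ∈ Y,
        ‖fderiv ℝ (wordMap Φ I) x‖ ≤ K * ‖fderiv ℝ (wordMap Φ I) y‖ ∧
        ‖wordMap Φ I x - wordMap Φ I y‖ ≤ K * (‖fderiv ℝ (wordMap Φ I) x‖ * ‖x - y‖) ∧
        ‖fderiv ℝ (wordMap Φ I) x‖ * ‖x - y‖ ≤ K * ‖wordMap Φ I x - wordMap Φ I y‖ := by
  cases nonempty_fintype ι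
  obtain ⟨hYc, hmaps, V, hVo, -, hYV, hV⟩ := hΦ
  choose hinj hC1 hcontr hconf hlow hupp hhol using hV
  choose ρ hρ0 hρ1 hρ using hcontr
  choose a' ha'0 ha' using hlow
  choose b' hb'1 hb' using hupp
  choose α hα c hc hhol using hhol
  have hdiff : ∀ i, ∀ x ∈ V, DifferentiableAt ℝ (Φ i) x := fun i x hx =>
    ((hC1 i).differentiableOn one_ne_zero).differentiableAt (hVo.mem_nhds hx)
  have hone : ∀ i, ∃ C : ℝ, 0 ≤ C ∧ ∀ x ∈ Y, ∀ y ∈ Y,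
      ‖fderiv ℝ (Φ i) x‖ ≤ ‖fderiv ℝ (Φ i) y‖ * Real.exp (C * ‖x - y‖ ^ α i) ∧
      ‖Φ i x - Φ i y‖ ≤ ‖fderiv ℝ (Φ i) x‖ * ‖x - y‖ * Real.exp (C * ‖x - y‖ ^ α i) ∧
      ‖fderiv ℝ (Φ i) x‖ * ‖x - y‖ ≤ ‖Φ i x - Φ i y‖ * Real.exp (C * ‖x - y‖ ^ α i) := fun i =>
    exists_holder_distortion hYc hVo hYV (hinj i) (hdiff i)
      (fun x hx y hy => (hρ i x hx y hy).trans
        (mul_le_of_le_one_left (norm_nonneg _) (hρ1 i).le))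
      (hconf i) (ha'0 i) (ha' i) (fun x hx => (hb' i x hx).trans (hb'1 i).le) (hα i) (hc i) (hhol i)
  choose C hC0 hC using hone
  obtain ⟨b, ⟨hb0, hb1⟩, hbρ, hbb'⟩ : ∃ b ∈ Ioo (0 : ℝ) 1, (∀ i, ρ i ≤ b) ∧ ∀ i, b' i ≤ b := by
    have h1 : ∀ᶠ b : ℝ in 𝓝[<] 1, ∀ i, ρ i ≤ b := eventually_all.2 fun i =>
      (eventually_ge_nhds (hρ1 i)).filter_mono nhdsWithin_le_nhds
    have h2 : ∀ᶠ b : ℝ in 𝓝[<] 1, ∀ i, b' i ≤ b := eventually_all.2 fun i =>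
      (eventually_ge_nhds (hb'1 i)).filter_mono nhdsWithin_le_nhds
    have h3 : ∀ᶠ b : ℝ in 𝓝[<] 1, b ∈ Ioo (0 : ℝ) 1 := Ioo_mem_nhdsLT one_pos
    obtain ⟨b, h1, h2, h3⟩ := (h1.and (h2.and h3)).exists
    exact ⟨b, h3, h1, h2⟩
  obtain ⟨a, ⟨ha0, ha1⟩, haa'⟩ : ∃ a ∈ Ioo (0 : ℝ) 1, ∀ i, a ≤ a' i := by
    have h1 : ∀ᶠ a : ℝ in 𝓝[>] 0, ∀ i, a ≤ a' i := eventually_all.2 fun i =>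
      (eventually_le_nhds (ha'0 i)).filter_mono nhdsWithin_le_nhds
    have h3 : ∀ᶠ a : ℝ in 𝓝[>] 0, a ∈ Ioo (0 : ℝ) 1 := Ioo_mem_nhdsGT one_pos
    obtain ⟨a, h1, h3⟩ := (h1.and h3).exists
    exact ⟨a, h3, h1⟩
  obtain ⟨D, hD0, hD⟩ : ∃ D : ℝ, 0 ≤ D ∧ ∀ x ∈ Y, ∀ y ∈ Y, ‖x - y‖ ≤ D := by
    obtain ⟨D, hD⟩ := Metric.isBounded_iff.1 hYc.isBounded
    exact ⟨|D|, abs_nonneg D, fun x hx y hy =>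
      (by simpa [dist_eq_norm] using hD hx hy : ‖x - y‖ ≤ D).trans (le_abs_self D)⟩
  have hdY : ∀ i, ∀ x ∈ Y, DifferentiableAt ℝ (Φ i) x := fun i x hx => hdiff i x (hYV hx)
  have hcY : ∀ i, ∀ x ∈ Y, ∀ v, ‖fderiv ℝ (Φ i) x v‖ = ‖fderiv ℝ (Φ i) x‖ * ‖v‖ :=
    fun i x hx => hconf i x (hYV hx)
  have hpY : ∀ i, ∀ x ∈ Y, 0 < ‖fderiv ℝ (Φ i) x‖ :=
    fun i x hx => (ha'0 i).trans_le (ha' i x (hYV hx))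
  have hcons := @norm_fderiv_wordMap_cons d ι Φ Y hmaps hdY hcY hpY
  have hnil := norm_fderiv_wordMap_nil (Φ := Φ)
  refine ⟨fun I J x hx => ?_, ?_⟩
  · induction I with
    | nil => rw [List.nil_append, hnil, one_mul]
    | cons i I ih =>
      rw [List.cons_append, hcons i _ hx, ih, hcons i I (mapsTo_wordMap hmaps J hx),
        wordMap_append, mul_assoc]
  -- A common modulus for all the maps, whose Hölder exponents and constants may differ.
  set ω : ℝ → ℝ := fun t => ∑ i, C i * t ^ α i with hω
  have hω0 : ∀ t, 0 ≤ t → 0 ≤ ω t := fun t ht =>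
    Finset.sum_nonneg fun i _ => mul_nonneg (hC0 i) (by positivity)
  have hωle : ∀ i t, 0 ≤ t → C i * t ^ α i ≤ ω t := fun i t ht =>
    Finset.single_le_sum (f := fun i => C i * t ^ α i)
      (fun i _ => mul_nonneg (hC0 i) (by positivity)) (Finset.mem_univ i)
  have hωmono : ∀ t u, 0 ≤ t → t ≤ u → ω t ≤ ω u := fun t u ht htu =>
    Finset.sum_le_sum fun i _ => mul_le_mul_of_nonneg_left
      (Real.rpow_le_rpow ht htu (hα i).le) (hC0 i)
  have hsum : Summable fun n : ℕ => ω (b ^ n * D) := by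
    refine summable_sum fun i _ => Summable.mul_left _ ?_
    have : ∀ n : ℕ, (b ^ n * D) ^ α i = (b ^ α i) ^ n * D ^ α i := fun n => by
      rw [Real.mul_rpow (by positivity) hD0, ← Real.rpow_natCast, ← Real.rpow_natCast,
        ← Real.rpow_mul hb0.le, ← Real.rpow_mul hb0.le, mul_comm (n : ℝ)]
    simp only [this]
    exact (summable_geometric_of_lt_one (by positivity)
      (Real.rpow_lt_one hb0.le hb1 (hα i))).mul_right _
  -- Prepending a letter to a word of length `k` costs a factor `exp (ω (b ^ k * D))`, because the
  -- images under that word are at most `b ^ k * D` apart. The total cost converges since `ω` is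
  -- summed along a geometric sequence.
  set σ : ℕ → ℝ := fun n => ∑ k ∈ Finset.range n, ω (b ^ k * D) with hσ
  have hσle : ∀ n, Real.exp (σ n) ≤ Real.exp (∑' n, ω (b ^ n * D)) := fun n =>
    Real.exp_le_exp.2 (hsum.sum_le_tsum _ fun k _ => hω0 _ (by positivity))
  have hσsucc : ∀ n, Real.exp (σ (n + 1)) = Real.exp (ω (b ^ n * D)) * Real.exp (σ n) := fun n => by
    rw [hσ, ← Real.exp_add]
    simp only [Finset.sum_range_succ]
    rw [add_comm]
  have hdist : ∀ I : List ι, ∀ x ∈ Y, ∀ y ∈ Y,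
      ‖wordMap Φ I x - wordMap Φ I y‖ ≤ b ^ I.length * D := by
    intro I x hx y hy
    induction I with
    | nil => simpa [wordMap] using hD x hx y hy
    | cons i I ih =>
      calc _ ≤ ρ i * ‖wordMap Φ I x - wordMap Φ I y‖ :=
            hρ i _ (hYV (mapsTo_wordMap hmaps I hx)) _ (hYV (mapsTo_wordMap hmaps I hy))
        _ ≤ b * (b ^ I.length * D) := by
            gcongr
            exact hbρ i
        _ = _ := by rw [List.length_cons]; ring
  have hmain : ∀ I : List ι, ∀ x ∈ Y, ∀ y ∈ Y,
      ‖fderiv ℝ (wordMap Φ I) x‖ ≤ Real.exp (σ I.length) * ‖fderiv ℝ (wordMap Φ I) y‖ ∧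
      ‖wordMap Φ I x - wordMap Φ I y‖
        ≤ Real.exp (σ I.length) * (‖fderiv ℝ (wordMap Φ I) x‖ * ‖x - y‖) ∧
      ‖fderiv ℝ (wordMap Φ I) x‖ * ‖x - y‖
        ≤ Real.exp (σ I.length) * ‖wordMap Φ I x - wordMap Φ I y‖ := by
    intro I x hx y hy
    induction I with
    | nil => simp [hσ, wordMap]
    | cons i I ih =>
      obtain ⟨ih1, ih2, ih3⟩ := ih
      have hIx := mapsTo_wordMap hmaps I hx
      have hIy := mapsTo_wordMap hmaps I hy
      obtain ⟨h1, h2, h3⟩ := hC i _ hIx _ hIy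
      have he : Real.exp (C i * ‖wordMap Φ I x - wordMap Φ I y‖ ^ α i)
          ≤ Real.exp (ω (b ^ I.length * D)) := Real.exp_le_exp.2 <|
        (hωle i _ (norm_nonneg _)).trans (hωmono _ _ (norm_nonneg _) (hdist I x hx y hy))
      rw [hcons i I hx, hcons i I hy, List.length_cons, hσsucc]
      set G := Real.exp (ω (b ^ I.length * D))
      set S := Real.exp (σ I.length)
      have hG : 0 < G := Real.exp_pos _
      have hS : 0 < S := Real.exp_pos _
      refine ⟨?_, ?_, ?_⟩
      · calc _ ≤ (‖fderiv ℝ (Φ i) (wordMap Φ I y)‖ * G)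
              * (S * ‖fderiv ℝ (wordMap Φ I) y‖) := by
              gcongr
              exact h1.trans (by gcongr)
          _ = _ := by ring
      · calc _ ≤ ‖fderiv ℝ (Φ i) (wordMap Φ I x)‖
              * (S * (‖fderiv ℝ (wordMap Φ I) x‖ * ‖x - y‖)) * G := h2.trans (by gcongr)
          _ = _ := by ring
      · calc _ = ‖fderiv ℝ (Φ i) (wordMap Φ I x)‖
              * (‖fderiv ℝ (wordMap Φ I) x‖ * ‖x - y‖) := by ring
          _ ≤ ‖fderiv ℝ (Φ i) (wordMap Φ I x)‖ * (S * ‖wordMap Φ I x - wordMap Φ I y‖) := by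
              gcongr
          _ = S * (‖fderiv ℝ (Φ i) (wordMap Φ I x)‖ * ‖wordMap Φ I x - wordMap Φ I y‖) := by
              ring
          _ ≤ S * (‖Φ i (wordMap Φ I x) - Φ i (wordMap Φ I y)‖ * G) := by
              refine mul_le_mul_of_nonneg_left (h3.trans ?_) hS.le
              gcongr
          _ = _ := by rw [wordMap]; simp only [Function.comp_apply]; ring
  refine ⟨Real.exp (∑' n, ω (b ^ n * D)), a, b,
    Real.one_le_exp (tsum_nonneg fun n => hω0 _ (by positivity)), ha0, ha1, hb0, hb1,
    fun I x hx => ⟨?_, ?_, fun y hy => ?_⟩⟩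
  · induction I with
    | nil => simp [hnil]
    | cons i I ih =>
      rw [hcons i I hx, List.length_cons, pow_succ']
      gcongr
      exact (haa' i).trans (ha' i _ (hYV (mapsTo_wordMap hmaps I hx)))
  · induction I with
    | nil => simp [hnil]
    | cons i I ih =>
      rw [hcons i I hx, List.length_cons, pow_succ']
      gcongr
      exact (hb' i _ (hYV (mapsTo_wordMap hmaps I hx))).trans (hbb' i)
  · obtain ⟨h1, h2, h3⟩ := hmain I x hx y hy
    have hle := hσle I.length
    exact ⟨h1.trans (mul_le_mul_of_nonneg_right hle (by positivity)),
      h2.trans (mul_le_mul_of_nonneg_right hle (by positivity)),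
      h3.trans (mul_le_mul_of_nonneg_right hle (by positivity))⟩

end Words

end ConformalIFS

/-! ### Abstract weight cocycles and their weight sums -/

/-- A positive multiplicative cocycle over maps of `Ω` indexed by finite words, which is exponentially
small in the word length and has bounded distortion. -/
structure WeightCocycle (κ Ω : Type*) where
  /-- the map attached to a word -/
  act : List κ → Ω → Ω
  /-- the weight of a word at a point -/
  weight : List κ → Ω → ℝ
  weight_append : ∀ I J x, weight (I ++ J) x = weight I (act J x) * weight J x
  /-- the distortion constant -/
  K : ℝ
  /-- the lower contraction rate -/
  a : ℝ
  /-- the upper contraction rate -/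
  b : ℝ
  one_le_K : 1 ≤ K
  a_pos : 0 < a
  a_lt_one : a < 1
  b_pos : 0 < b
  b_lt_one : b < 1
  pow_le_weight : ∀ I x, a ^ I.length ≤ weight I x
  weight_le_pow : ∀ I x, weight I x ≤ b ^ I.length
  distortion : ∀ I x y, weight I x ≤ K * weight I y

namespace WeightCocycle

variable {κ Ω : Type*} (C : WeightCocycle κ Ω)

theorem K_pos : 0 < C.K := one_pos.trans_le C.one_le_K

theorem weight_pos (I : List κ) (x : Ω) : 0 < C.weight I x :=
  (pow_pos C.a_pos _).trans_le (C.pow_le_weight I x)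

theorem weight_le_one (I : List κ) (x : Ω) : C.weight I x ≤ 1 :=
  (C.weight_le_pow I x).trans (pow_le_one₀ C.b_pos.le C.b_lt_one.le)

theorem weight_nil (x : Ω) : C.weight [] x = 1 :=
  le_antisymm (C.weight_le_one [] x) (by simpa using C.pow_le_weight [] x)

/-- The cocycle obtained by reading words over an alphabet of blocks of constant length. -/
def blocks {κ' : Type*} (w : κ' → List κ) {N : ℕ} (hN : N ≠ 0) (hw : ∀ k, (w k).length = N) :
    WeightCocycle κ' Ω where
  act L := C.act (L.flatMap w)
  weight L := C.weight (L.flatMap w)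
  weight_append I J x := by rw [List.flatMap_append, C.weight_append]
  K := C.K
  a := C.a ^ N
  b := C.b ^ N
  one_le_K := C.one_le_K
  a_pos := pow_pos C.a_pos N
  a_lt_one := pow_lt_one₀ C.a_pos.le C.a_lt_one hN
  b_pos := pow_pos C.b_pos N
  b_lt_one := pow_lt_one₀ C.b_pos.le C.b_lt_one hN
  pow_le_weight L x := by
    have h : (L.flatMap w).length = N * L.length := by
      simp [List.length_flatMap, hw, mul_comm]
    rw [← pow_mul, ← h]
    exact C.pow_le_weight _ x
  weight_le_pow L x := by
    have h : (L.flatMap w).length = N * L.length := by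
      simp [List.length_flatMap, hw, mul_comm]
    rw [← pow_mul, ← h]
    exact C.weight_le_pow _ x
  distortion I := C.distortion _

variable [Fintype κ]

/-- The sum of the `s`-th powers of the weights of all words of length `n`. -/
noncomputable def weightSum (s : ℝ) (n : ℕ) (x : Ω) : ℝ :=
  ∑ I : Fin n → κ, C.weight (List.ofFn I) x ^ s

theorem weightSum_nonneg (s : ℝ) (n : ℕ) (x : Ω) : 0 ≤ C.weightSum s n x :=
  Finset.sum_nonneg fun _ _ => Real.rpow_nonneg (C.weight_pos _ _).le _

theorem weightSum_pos [Nonempty κ] (s : ℝ) (n : ℕ) (x : Ω) : 0 < C.weightSum s n x :=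
  Finset.sum_pos (fun _ _ => Real.rpow_pos_of_pos (C.weight_pos _ _) _) Finset.univ_nonempty

theorem weightSum_zero (s : ℝ) (x : Ω) : C.weightSum s 0 x = 1 := by
  simp [weightSum, weight_nil]

theorem weightSum_add (s : ℝ) (m n : ℕ) (x : Ω) :
    C.weightSum s (m + n) x = ∑ J : Fin n → κ,
      C.weight (List.ofFn J) x ^ s * C.weightSum s m (C.act (List.ofFn J) x) := by
  rw [weightSum, ← (Fin.appendEquiv m n).sum_comp, Fintype.sum_prod_type, Finset.sum_comm]
  refine Finset.sum_congr rfl fun J _ => ?_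
  rw [weightSum, Finset.mul_sum]
  refine Finset.sum_congr rfl fun I _ => ?_
  rw [show Fin.appendEquiv m n (I, J) = Fin.append I J from rfl, List.ofFn_fin_append, C.weight_append,
    Real.mul_rpow (C.weight_pos _ _).le (C.weight_pos _ _).le, mul_comm]

/-- All real `s` are allowed because the zero of the pressure is to be unique in `ℝ`. For `s ≤ 0`
distortion is applied with the two points exchanged, whence `|s|`. -/
theorem weightSum_le (s : ℝ) (n : ℕ) (x y : Ω) :
    C.weightSum s n x ≤ C.K ^ |s| * C.weightSum s n y := by
  rw [weightSum, weightSum, Finset.mul_sum]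
  refine Finset.sum_le_sum fun I _ => ?_
  have hx := C.weight_pos (List.ofFn I) x
  have hy := C.weight_pos (List.ofFn I) y
  rcases le_total 0 s with hs | hs
  · rw [abs_of_nonneg hs, ← Real.mul_rpow C.K_pos.le hy.le]
    exact Real.rpow_le_rpow hx.le (C.distortion _ _ _) hs
  · rw [abs_of_nonpos hs, Real.rpow_neg C.K_pos.le, ← div_eq_inv_mul,
      ← Real.div_rpow hy.le C.K_pos.le]
    refine Real.rpow_le_rpow_of_nonpos (div_pos hy C.K_pos) ?_ hs
    rw [div_le_iff₀' C.K_pos]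
    exact C.distortion _ _ _

theorem weightSum_add_le (s : ℝ) (m n : ℕ) (x : Ω) :
    C.weightSum s (m + n) x ≤ C.K ^ |s| * C.weightSum s m x * C.weightSum s n x := by
  rw [weightSum_add, weightSum.eq_def C s n, Finset.mul_sum]
  refine Finset.sum_le_sum fun J _ => ?_
  rw [mul_comm]
  exact mul_le_mul_of_nonneg_right (C.weightSum_le s m _ x)
    (Real.rpow_nonneg (C.weight_pos _ _).le _)

theorem le_weightSum_add (s : ℝ) (m n : ℕ) (x : Ω) :
    C.weightSum s m x * C.weightSum s n x ≤ C.K ^ |s| * C.weightSum s (m + n) x := by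
  rw [weightSum_add, weightSum.eq_def C s n, Finset.mul_sum, Finset.mul_sum]
  refine Finset.sum_le_sum fun J _ => ?_
  have := mul_le_mul_of_nonneg_right (C.weightSum_le s m x (C.act (List.ofFn J) x))
    (Real.rpow_nonneg (C.weight_pos (List.ofFn J) x).le s)
  linarith

theorem weightSum_le_of_le {s t : ℝ} (h : s ≤ t) (n : ℕ) (x : Ω) :
    C.weightSum t n x ≤ (C.b ^ (t - s)) ^ n * C.weightSum s n x := by
  rw [weightSum, weightSum, Finset.mul_sum]
  refine Finset.sum_le_sum fun I _ => ?_
  have hx := C.weight_pos (List.ofFn I) x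
  have h1 : C.weight (List.ofFn I) x ^ t
      = C.weight (List.ofFn I) x ^ (t - s) * C.weight (List.ofFn I) x ^ s := by
    rw [← Real.rpow_add hx, sub_add_cancel]
  rw [h1, ← Real.rpow_natCast, ← Real.rpow_mul C.b_pos.le, mul_comm (t - s), Real.rpow_mul C.b_pos.le,
    Real.rpow_natCast]
  gcongr
  simpa using C.weight_le_pow (List.ofFn I) x

theorem le_weightSum_of_le {s t : ℝ} (h : s ≤ t) (n : ℕ) (x : Ω) :
    (C.a ^ (t - s)) ^ n * C.weightSum s n x ≤ C.weightSum t n x := by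
  rw [weightSum, weightSum, Finset.mul_sum]
  refine Finset.sum_le_sum fun I _ => ?_
  have hx := C.weight_pos (List.ofFn I) x
  have h1 : C.weight (List.ofFn I) x ^ t
      = C.weight (List.ofFn I) x ^ (t - s) * C.weight (List.ofFn I) x ^ s := by
    rw [← Real.rpow_add hx, sub_add_cancel]
  have ha := C.a_pos
  rw [h1, ← Real.rpow_natCast, ← Real.rpow_mul C.a_pos.le, mul_comm (t - s), Real.rpow_mul C.a_pos.le,
    Real.rpow_natCast]
  gcongr
  simpa using C.pow_le_weight (List.ofFn I) x

theorem weightSum_zero_exponent (n : ℕ) (x : Ω) : C.weightSum 0 n x = (Fintype.card κ : ℝ) ^ n := by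
  simp [weightSum]

/-! ### The pressure and its zero -/

/-- Fekete's lemma: adding the constant `log (K ^ |s|)` turns almost subadditivity into
subadditivity. The constant words already give a linear lower bound. -/
theorem exists_tendsto_log_weightSum [Nonempty κ] (s : ℝ) (x : Ω) :
    ∃ p : ℝ, Tendsto (fun n : ℕ => 1 / (n : ℝ) * Real.log (C.weightSum s n x)) atTop (𝓝 p) := by
  set k := Real.log (C.K ^ |s|) with hk
  have hKs : 0 < C.K ^ |s| := Real.rpow_pos_of_pos C.K_pos _
  have hk0 : 0 ≤ k := Real.log_nonneg (Real.one_le_rpow C.one_le_K (abs_nonneg s))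
  have hsub : Subadditive fun n => k + Real.log (C.weightSum s n x) := fun m n => by
    have h1 := Real.log_le_log (C.weightSum_pos s (m + n) x) (C.weightSum_add_le s m n x)
    rw [Real.log_mul (mul_pos hKs (C.weightSum_pos s m x)).ne' (C.weightSum_pos s n x).ne',
      Real.log_mul hKs.ne' (C.weightSum_pos s m x).ne'] at h1
    simp only
    linarith
  have hbdd : BddBelow (range fun n : ℕ => (k + Real.log (C.weightSum s n x)) / (n : ℝ)) := by
    refine ⟨Real.log (C.a ^ |s|), ?_⟩
    rintro _ ⟨n, rfl⟩
    have ha := C.a_pos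
    have hneg : Real.log (C.a ^ |s|) ≤ 0 :=
      Real.log_nonpos (by positivity) (Real.rpow_le_one ha.le C.a_lt_one.le (abs_nonneg s))
    rcases Nat.eq_zero_or_pos n with rfl | hn
    · simpa using hneg
    have hn' : (0 : ℝ) < n := by exact_mod_cast hn
    simp only
    rw [le_div_iff₀ hn', mul_comm, ← Real.log_pow]
    have h2 : (C.a ^ |s|) ^ n ≤ C.weightSum s n x := by
      obtain ⟨i⟩ := ‹Nonempty κ›
      refine le_trans ?_ (Finset.single_le_sum (f := fun I : Fin n → κ =>
        C.weight (List.ofFn I) x ^ s) (fun I _ => Real.rpow_nonneg (C.weight_pos _ _).le _)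
        (Finset.mem_univ fun _ => i))
      rw [← Real.rpow_natCast, ← Real.rpow_mul ha.le, mul_comm, Real.rpow_mul ha.le,
        Real.rpow_natCast]
      have h3 := C.pow_le_weight (List.ofFn fun _ : Fin n => i) x
      rw [List.length_ofFn] at h3
      refine (Real.rpow_le_rpow (by positivity) h3 (abs_nonneg s)).trans ?_
      exact Real.rpow_le_rpow_of_exponent_ge (C.weight_pos _ _) (C.weight_le_one _ _) (le_abs_self s)
    linarith [Real.log_le_log (by positivity) h2]
  refine ⟨hsub.lim, ?_⟩
  have h4 := (hsub.tendsto_lim hbdd).sub (tendsto_const_div_atTop_nhds_zero_nat k)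
  rw [sub_zero] at h4
  refine h4.congr fun n => ?_
  ring

/-- The pressure function. -/
noncomputable def pressure [Nonempty κ] (x : Ω) (s : ℝ) : ℝ :=
  (C.exists_tendsto_log_weightSum s x).choose

theorem tendsto_pressure [Nonempty κ] (x : Ω) (s : ℝ) :
    Tendsto (fun n : ℕ => 1 / (n : ℝ) * Real.log (C.weightSum s n x)) atTop
      (𝓝 (C.pressure x s)) :=
  (C.exists_tendsto_log_weightSum s x).choose_spec

theorem one_div_mul_log_pow_mul {q z : ℝ} (hq : 0 < q) (hz : 0 < z) {n : ℕ} (hn : n ≠ 0) :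
    1 / (n : ℝ) * Real.log (q ^ n * z) = Real.log q + 1 / (n : ℝ) * Real.log z := by
  rw [Real.log_mul (by positivity) hz.ne', Real.log_pow]
  field_simp

/-- Together with `le_pressure`, this confines the slopes of the pressure to `[log a, log b]`, which
gives strict decrease and Lipschitz continuity. -/
theorem pressure_le [Nonempty κ] (x : Ω) {s t : ℝ} (h : s ≤ t) :
    C.pressure x t ≤ (t - s) * Real.log C.b + C.pressure x s := by
  refine le_of_tendsto_of_tendsto (C.tendsto_pressure x t)
    ((C.tendsto_pressure x s).const_add _) ?_
  filter_upwards [eventually_ne_atTop 0] with n hn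
  rw [← Real.log_rpow C.b_pos, ← one_div_mul_log_pow_mul (Real.rpow_pos_of_pos C.b_pos _)
    (C.weightSum_pos s n x) hn]
  exact mul_le_mul_of_nonneg_left (Real.log_le_log (C.weightSum_pos t n x)
    (C.weightSum_le_of_le h n x)) (by positivity)

theorem le_pressure [Nonempty κ] (x : Ω) {s t : ℝ} (h : s ≤ t) :
    (t - s) * Real.log C.a + C.pressure x s ≤ C.pressure x t := by
  refine le_of_tendsto_of_tendsto ((C.tendsto_pressure x s).const_add _)
    (C.tendsto_pressure x t) ?_
  filter_upwards [eventually_ne_atTop 0] with n hn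
  have ha := C.a_pos
  have hz := C.weightSum_pos s n x
  rw [← Real.log_rpow C.a_pos, ← one_div_mul_log_pow_mul (Real.rpow_pos_of_pos C.a_pos _) hz hn]
  exact mul_le_mul_of_nonneg_left (Real.log_le_log (by positivity)
    (C.le_weightSum_of_le h n x)) (by positivity)

theorem pressure_zero [Nonempty κ] (x : Ω) : C.pressure x 0 = Real.log (Fintype.card κ) := by
  refine tendsto_nhds_unique (C.tendsto_pressure x 0) (tendsto_const_nhds.congr' ?_)
  filter_upwards [eventually_ne_atTop 0] with n hn
  rw [weightSum_zero_exponent, Real.log_pow]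
  field_simp

theorem strictAnti_pressure [Nonempty κ] (x : Ω) : StrictAnti (C.pressure x) := fun s t h => by
  have h1 := C.pressure_le x h.le
  have h2 := Real.log_neg C.b_pos C.b_lt_one
  nlinarith

theorem continuous_pressure [Nonempty κ] (x : Ω) : Continuous (C.pressure x) := by
  have hle : ∀ s t, s ≤ t →
      dist (C.pressure x s) (C.pressure x t) ≤ |Real.log C.a| * dist s t := fun s t h => by
    have h1 := C.le_pressure x h
    have h2 := (C.strictAnti_pressure x).antitone h
    have h3 := Real.log_neg C.a_pos C.a_lt_one
    rw [Real.dist_eq, Real.dist_eq, abs_of_nonneg (by linarith), abs_of_neg h3,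
      abs_of_nonpos (by linarith : s - t ≤ 0)]
    nlinarith
  refine (LipschitzWith.of_dist_le_mul (K := ⟨|Real.log C.a|, abs_nonneg _⟩) fun s t => ?_).continuous
  rcases le_total s t with h | h
  · exact hle s t h
  · rw [dist_comm, dist_comm s]
    exact hle t s h

theorem exists_pressure_eq_zero [Nontrivial κ] (x : Ω) : ∃ s, 0 < s ∧ C.pressure x s = 0 := by
  have hl : 0 < Real.log (Fintype.card κ) :=
    Real.log_pos (by exact_mod_cast Fintype.one_lt_card)
  have hb := Real.log_neg C.b_pos C.b_lt_one
  -- The point where the line of slope `log b` through the value at `0` vanishes.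
  set t := Real.log (Fintype.card κ) / (-Real.log C.b) with ht
  have ht0 : 0 ≤ t := (div_pos hl (neg_pos.2 hb)).le
  have h1 : C.pressure x t ≤ 0 := by
    have h2 := C.pressure_le x ht0
    have h3 : (t - 0) * Real.log C.b = -Real.log (Fintype.card κ) := by
      rw [ht, sub_zero]
      field_simp [hb.ne]
    rw [h3, pressure_zero, neg_add_cancel] at h2
    exact h2
  have h4 : (0 : ℝ) ∈ Icc (C.pressure x t) (C.pressure x 0) :=
    ⟨h1, by rw [pressure_zero]; exact hl.le⟩
  obtain ⟨s, hs, hs0⟩ := intermediate_value_Icc' ht0 (C.continuous_pressure x).continuousOn h4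
  refine ⟨s, lt_of_le_of_ne hs.1 fun h => ?_, hs0⟩
  rw [← h, pressure_zero] at hs0
  exact hl.ne' hs0

/-- A subadditive sequence with vanishing linear growth rate is nonnegative. -/
theorem _root_.Subadditive.nonneg_of_tendsto_zero {u : ℕ → ℝ} (h : Subadditive u)
    (hu : Tendsto (fun n : ℕ => u n / n) atTop (𝓝 0)) {n : ℕ} (hn : n ≠ 0) : 0 ≤ u n := by
  have hb := hu.bddBelow_range
  have h1 := h.lim_le_div hb hn
  rw [tendsto_nhds_unique (h.tendsto_lim hb) hu] at h1
  have hn' : (0 : ℝ) < n := by exact_mod_cast Nat.pos_of_ne_zero hn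
  exact (div_nonneg_iff.1 h1).elim (fun h => h.1) fun h => absurd hn' h.2.not_gt

theorem tendsto_const_add_log_div [Nonempty κ] {x : Ω} {s : ℝ} (h : C.pressure x s = 0) (k : ℝ) :
    Tendsto (fun n : ℕ => (k + Real.log (C.weightSum s n x)) / n) atTop (𝓝 0) := by
  have h1 := (tendsto_const_div_atTop_nhds_zero_nat k).add (C.tendsto_pressure x s)
  rw [h, add_zero] at h1
  refine h1.congr fun n => ?_
  ring

/-- The limit in Fekete's lemma is an infimum, so growth rate zero forces each corrected logarithm
to be nonnegative. The opposite bound below follows in the same way from supermultiplicativity. -/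
theorem one_le_weightSum_of_pressure_eq_zero [Nonempty κ] {x : Ω} {s : ℝ}
    (h : C.pressure x s = 0) (n : ℕ) : 1 ≤ C.K ^ |s| * C.weightSum s n x := by
  have hKs1 : 1 ≤ C.K ^ |s| := Real.one_le_rpow C.one_le_K (abs_nonneg s)
  have hKs : 0 < C.K ^ |s| := one_pos.trans_le hKs1
  rcases eq_or_ne n 0 with rfl | hn
  · rwa [weightSum_zero, mul_one]
  have hsub : Subadditive fun n => Real.log (C.K ^ |s|) + Real.log (C.weightSum s n x) :=
    fun m n => by
      have h1 := Real.log_le_log (C.weightSum_pos s (m + n) x) (C.weightSum_add_le s m n x)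
      rw [Real.log_mul (mul_pos hKs (C.weightSum_pos s m x)).ne' (C.weightSum_pos s n x).ne',
        Real.log_mul hKs.ne' (C.weightSum_pos s m x).ne'] at h1
      simp only
      linarith
  have h2 := hsub.nonneg_of_tendsto_zero (C.tendsto_const_add_log_div h _) hn
  rw [← Real.log_mul hKs.ne' (C.weightSum_pos s n x).ne'] at h2
  exact (Real.log_nonneg_iff (mul_pos hKs (C.weightSum_pos s n x))).1 h2

theorem weightSum_le_of_pressure_eq_zero [Nonempty κ] {x : Ω} {s : ℝ}
    (h : C.pressure x s = 0) (n : ℕ) : C.weightSum s n x ≤ C.K ^ |s| := by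
  have hKs1 : 1 ≤ C.K ^ |s| := Real.one_le_rpow C.one_le_K (abs_nonneg s)
  have hKs : 0 < C.K ^ |s| := one_pos.trans_le hKs1
  rcases eq_or_ne n 0 with rfl | hn
  · rwa [weightSum_zero]
  have hsub : Subadditive fun n => -(-Real.log (C.K ^ |s|) + Real.log (C.weightSum s n x)) :=
    fun m n => by
      have h1 := Real.log_le_log (mul_pos (C.weightSum_pos s m x) (C.weightSum_pos s n x))
        (C.le_weightSum_add s m n x)
      rw [Real.log_mul (C.weightSum_pos s m x).ne' (C.weightSum_pos s n x).ne',
        Real.log_mul hKs.ne' (C.weightSum_pos s (m + n) x).ne'] at h1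
      simp only
      linarith
  have ht := (C.tendsto_const_add_log_div h (-Real.log (C.K ^ |s|))).neg
  simp only [← neg_div, neg_zero] at ht
  have h2 := hsub.nonneg_of_tendsto_zero ht hn
  exact (Real.log_le_log_iff (C.weightSum_pos s n x) hKs).1 (by linarith)

/-- Constant factors disappear in the growth rate; this serves the infimum, the supremum and a
change of base point. -/
theorem tendsto_log_of_comparable [Nonempty κ] (x : Ω) (s : ℝ) {v : ℕ → ℝ} {k : ℝ} (hk : 0 < k)
    (h1 : ∀ n, v n ≤ k * C.weightSum s n x) (h2 : ∀ n, C.weightSum s n x ≤ k * v n) :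
    Tendsto (fun n : ℕ => 1 / (n : ℝ) * Real.log (v n)) atTop (𝓝 (C.pressure x s)) := by
  have hv : ∀ n, 0 < v n := fun n =>
    pos_of_mul_pos_right ((C.weightSum_pos s n x).trans_le (h2 n)) hk.le
  have hc := tendsto_const_div_atTop_nhds_zero_nat (Real.log k)
  have hlo := (C.tendsto_pressure x s).sub hc
  have hup := hc.add (C.tendsto_pressure x s)
  rw [sub_zero] at hlo
  rw [zero_add] at hup
  refine tendsto_of_tendsto_of_tendsto_of_le_of_le hlo hup (fun n => ?_) fun n => ?_
  · have h3 := Real.log_le_log (C.weightSum_pos s n x) (h2 n)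
    rw [Real.log_mul hk.ne' (hv n).ne'] at h3
    have h4 := mul_le_mul_of_nonneg_left h3 (show 0 ≤ 1 / (n : ℝ) by positivity)
    have h5 : Real.log k / n = 1 / (n : ℝ) * Real.log k := by ring
    simp only [h5]
    linarith
  · have h3 := Real.log_le_log (hv n) (h1 n)
    rw [Real.log_mul hk.ne' (C.weightSum_pos s n x).ne'] at h3
    have h4 := mul_le_mul_of_nonneg_left h3 (show 0 ≤ 1 / (n : ℝ) by positivity)
    have h5 : Real.log k / n = 1 / (n : ℝ) * Real.log k := by ring
    simp only [h5]
    linarith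

theorem weightSum_succ (s : ℝ) (n : ℕ) (x : Ω) :
    C.weightSum s (n + 1) x = ∑ i, C.weight [i] x ^ s * C.weightSum s n (C.act [i] x) := by
  rw [weightSum_add]
  exact Fintype.sum_equiv (Equiv.funUnique (Fin 1) κ) _ _ fun J => by simp

theorem pressure_eq [Nonempty κ] (x y : Ω) (s : ℝ) : C.pressure x s = C.pressure y s :=
  tendsto_nhds_unique (C.tendsto_pressure x s)
    (C.tendsto_log_of_comparable y s (Real.rpow_pos_of_pos C.K_pos _)
      (fun n => C.weightSum_le s n x y) fun n => C.weightSum_le s n y x)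

/-! ### Omitting a block lowers the critical exponent -/

section RemoveBlock

variable {N : ℕ} (J : Fin N → κ)

/-- The cocycle obtained by reading words in blocks of length `N` and omitting the block `J`. -/
def removeBlock (hN : N ≠ 0) : WeightCocycle {A : Fin N → κ // A ≠ J} Ω :=
  C.blocks (fun A => List.ofFn A.1) hN fun _ => List.length_ofFn

/-- A renewal inequality. Words of `k` blocks either avoid `J`, or have a rightmost occurrence of
`J` with some number `j < k` of `J`-free blocks to its right. In the latter case, `J` and everything
to its left contribute at least `η`. -/
theorem removeBlock_weightSum_add_le [DecidableEq κ] (hN : N ≠ 0) {s η : ℝ}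
    (hη : ∀ n x, η ≤ C.weight (List.ofFn J) x ^ s * C.weightSum s n (C.act (List.ofFn J) x))
    (k : ℕ) (x : Ω) :
    (C.removeBlock J hN).weightSum s k x
      + η * ∑ j ∈ Finset.range k, (C.removeBlock J hN).weightSum s j x
      ≤ C.weightSum s (k * N) x := by
  induction k generalizing x with
  | zero => simp [weightSum_zero]
  | succ k ih =>
    -- The innermost block is split off: if it is `J` it pays for the term `j = 0`, otherwise the
    -- induction applies at the image point.
    rw [add_one_mul, C.weightSum_add s (k * N) N, Fintype.sum_eq_add_sum_subtype_ne _ J, Finset.sum_range_succ',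
      weightSum_zero, mul_add, mul_one, Finset.mul_sum]
    simp only [weightSum_succ]
    rw [← Finset.mul_sum, Finset.sum_comm]
    simp only [← Finset.mul_sum]
    rw [Finset.mul_sum]
    have h1 : ∀ A : {A : Fin N → κ // A ≠ J},
        (C.removeBlock J hN).weight [A] x ^ s
            * (C.removeBlock J hN).weightSum s k ((C.removeBlock J hN).act [A] x)
          + η * ((C.removeBlock J hN).weight [A] x ^ s * ∑ j ∈ Finset.range k,
            (C.removeBlock J hN).weightSum s j ((C.removeBlock J hN).act [A] x))
          ≤ C.weight (List.ofFn A.1) x ^ s * C.weightSum s (k * N) (C.act (List.ofFn A.1) x) := by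
      intro A
      have h2 : (C.removeBlock J hN).weight [A] x = C.weight (List.ofFn A.1) x := by
        simp [removeBlock, blocks]
      have h3 : (C.removeBlock J hN).act [A] x = C.act (List.ofFn A.1) x := by
        simp [removeBlock, blocks]
      rw [h2, h3]
      have := mul_le_mul_of_nonneg_left (ih (C.act (List.ofFn A.1) x))
        (Real.rpow_nonneg (C.weight_pos (List.ofFn A.1) x).le s)
      linarith
    have h4 := Finset.sum_le_sum fun A (_ : A ∈ Finset.univ) => h1 A
    rw [Finset.sum_add_distrib] at h4
    linarith [hη (k * N) x]

/-- Once the weight sums of some length are at most `1 / 2`, the series of all weight sums is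
bounded uniformly. -/
theorem exists_sum_range_weightSum_le {s : ℝ} (hs : 0 ≤ s) {k : ℕ} (hk : k ≠ 0)
    (h : ∀ x, C.weightSum s k x ≤ 1 / 2) :
    ∃ M : ℝ, ∀ n x, ∑ j ∈ Finset.range n, C.weightSum s j x ≤ M := by
  set M := ∑ j ∈ Finset.range k, (Fintype.card κ : ℝ) ^ j with hM
  have hM0 : 0 ≤ M := by positivity
  have hk' : ∀ x, ∑ j ∈ Finset.range k, C.weightSum s j x ≤ M := fun x =>
    Finset.sum_le_sum fun j _ => by
      have h1 := C.weightSum_le_of_le hs j x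
      rw [sub_zero, weightSum_zero_exponent] at h1
      refine h1.trans (mul_le_of_le_one_left (by positivity) ?_)
      exact pow_le_one₀ (Real.rpow_nonneg C.b_pos.le _)
        (Real.rpow_le_one C.b_pos.le C.b_lt_one.le hs)
  -- `2 * M` is the fixed point of `B ↦ M + B / 2`: the first `k` terms give at most `M`, and the
  -- remaining ones factor through length `k`.
  refine ⟨2 * M, fun n => ?_⟩
  induction n using Nat.strong_induction_on with
  | _ n ih =>
    intro x
    rcases le_total n k with hnk | hkn
    · have := Finset.sum_le_sum_of_subset_of_nonneg (f := fun j => C.weightSum s j x)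
        (Finset.range_subset_range.2 hnk) fun j _ _ => C.weightSum_nonneg s j x
      linarith [hk' x]
    · obtain ⟨m, rfl⟩ := Nat.exists_eq_add_of_le hkn
      have ihm := ih m (by omega)
      rw [Finset.sum_range_add]
      have h2 : ∑ j ∈ Finset.range m, C.weightSum s (k + j) x ≤ M := by
        simp only [add_comm k, weightSum_add]
        rw [Finset.sum_comm]
        simp only [← Finset.mul_sum]
        calc _ ≤ ∑ I : Fin k → κ, C.weight (List.ofFn I) x ^ s * (2 * M) :=
              Finset.sum_le_sum fun I _ => mul_le_mul_of_nonneg_left (ihm _)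
                (Real.rpow_nonneg (C.weight_pos _ _).le _)
          _ = C.weightSum s k x * (2 * M) := by rw [weightSum, Finset.sum_mul]
          _ ≤ 1 / 2 * (2 * M) := by
              gcongr
              exact h x
          _ = M := by ring
      linarith [hk' x]

/-- Omitting a block lowers the critical exponent. -/
theorem exists_lt_sum_range_removeBlock_le [DecidableEq κ] [Nonempty κ] [Nonempty Ω]
    (hN : N ≠ 0) {s : ℝ} (hs : 0 < s)
    (h : ∀ x, C.pressure x s = 0) :
    ∃ τ, 0 < τ ∧ τ < s ∧ ∃ M : ℝ, ∀ n x,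
      ∑ j ∈ Finset.range n, (C.removeBlock J hN).weightSum τ j x ≤ M := by
  obtain ⟨x₀⟩ := ‹Nonempty Ω›
  set B := C.removeBlock J hN with hB
  have hK : 0 < C.K ^ |s| := Real.rpow_pos_of_pos C.K_pos _
  -- The least weight of a block, times the lower bound for weight sums at the zero of the pressure.
  set η := (C.a ^ N) ^ s * (C.K ^ |s|)⁻¹ with hηdef
  have ha := C.a_pos
  have hη0 : 0 < η := by positivity
  have hη : ∀ n x, η ≤ C.weight (List.ofFn J) x ^ s * C.weightSum s n (C.act (List.ofFn J) x) := by
    intro n x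
    have hw := C.pow_le_weight (List.ofFn J) x
    rw [List.length_ofFn] at hw
    refine mul_le_mul (Real.rpow_le_rpow (by positivity) hw hs.le) ?_ (by positivity)
      (Real.rpow_nonneg (C.weight_pos _ _).le _)
    rw [inv_le_iff_one_le_mul₀' hK]
    exact C.one_le_weightSum_of_pressure_eq_zero (h _) n
  have hsum : ∀ k, ∑ j ∈ Finset.range k, B.weightSum s j x₀ ≤ C.K ^ |s| / η := by
    intro k
    rw [le_div_iff₀' hη0]
    have h1 := C.removeBlock_weightSum_add_le J hN hη k x₀
    have h2 := C.weightSum_le_of_pressure_eq_zero (h x₀) (k * N)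
    have h3 := B.weightSum_nonneg s k x₀
    linarith
  -- The full sums stay bounded at `s`, so the renewal inequality makes the `J`-free sums summable,
  -- and in particular they tend to zero.
  have hlim := (summable_of_sum_range_le (fun j => B.weightSum_nonneg s j x₀) hsum).tendsto_atTop_zero
  obtain ⟨k, hk⟩ := (hlim.eventually_lt_const (show 0 < 1 / 4 / C.K ^ |s| by positivity)).exists
  have hk4 : ∀ x, B.weightSum s k x ≤ 1 / 4 := fun x => by
    have h1 : B.weightSum s k x ≤ C.K ^ |s| * B.weightSum s k x₀ := B.weightSum_le s k x x₀
    rw [lt_div_iff₀' hK] at hk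
    linarith
  have hk0 : k ≠ 0 := by
    rintro rfl
    have := hk4 x₀
    rw [weightSum_zero] at this
    norm_num at this
  -- The passage from `s` to `τ` costs a factor less than `2` at level `k`, turning `1 / 4` into `1
  -- / 2`.
  obtain ⟨τ, hτ, hτ0, hτs⟩ : ∃ τ, 1 / 2 < (B.a ^ (s - τ)) ^ k ∧ 0 < τ ∧ τ < s := by
    have hc : Tendsto (fun τ : ℝ => (B.a ^ (s - τ)) ^ k) (𝓝[<] s) (𝓝 ((B.a ^ (s - s)) ^ k)) := by
      refine Tendsto.mono_left (Continuous.tendsto ?_ s) nhdsWithin_le_nhds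
      exact (Real.continuous_const_rpow B.a_pos.ne').comp (by fun_prop) |>.pow k
    rw [sub_self, Real.rpow_zero, one_pow] at hc
    have h1 : ∀ᶠ τ : ℝ in 𝓝[<] s, τ ∈ Ioo 0 s := Ioo_mem_nhdsLT hs
    obtain ⟨τ, hτ, h2⟩ := ((hc.eventually_const_lt (by norm_num : (1 / 2 : ℝ) < 1)).and h1).exists
    exact ⟨τ, hτ, h2.1, h2.2⟩
  refine ⟨τ, hτ0, hτs, B.exists_sum_range_weightSum_le hτ0.le hk0 fun x => ?_⟩
  have h1 := B.le_weightSum_of_le hτs.le k x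
  have h2 := hk4 x
  have h3 := B.weightSum_nonneg τ k x
  nlinarith

end RemoveBlock

end WeightCocycle

theorem WeightCocycle.tsum_weight_rpow {κ Ω : Type*} [Fintype κ] (C : WeightCocycle κ Ω) (s : ℝ)
    (x : Ω) : ∑' L : List κ, ENNReal.ofReal (C.weight L x ^ s)
      = ∑' n : ℕ, ENNReal.ofReal (C.weightSum s n x) := by
  rw [← List.equivSigmaTuple.symm.tsum_eq, ENNReal.tsum_sigma']
  refine tsum_congr fun n => ?_
  rw [tsum_fintype, weightSum, ENNReal.ofReal_sum_of_nonneg fun I _ =>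
    Real.rpow_nonneg (C.weight_pos _ _).le _]
  rfl

/-! ### The derivative cocycle on the attractor and the divergence condition -/

namespace ConformalIFS

/-- The cocycle `C` on `X` is given by the maps `φ_I` and the norms of their differentials, which
are comparable to all difference quotients. -/
structure IsDerivCocycle {d : ℕ} {ι : Type*} (Φ : ι → E d → E d) (X : Set (E d))
    (C : WeightCocycle ι X) : Prop where
  act_eq : ∀ I x, (C.act I x : E d) = wordMap Φ I x
  weight_eq : ∀ I x, C.weight I x = ‖fderiv ℝ (wordMap Φ I) x‖
  norm_sub_le : ∀ I (x y : X),
    ‖wordMap Φ I x - wordMap Φ I y‖ ≤ C.K * (C.weight I x * ‖(x : E d) - y‖)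
  le_norm_sub : ∀ I (x y : X),
    C.weight I x * ‖(x : E d) - y‖ ≤ C.K * ‖wordMap Φ I x - wordMap Φ I y‖

theorem IsAttractor.mapsTo {d : ℕ} {ι : Type*} {Φ : ι → E d → E d} {Y X : Set (E d)}
    (hX : IsAttractor Φ Y X) (i : ι) : MapsTo (Φ i) X X := fun x hx => by
  rw [hX.eq_iUnion]
  exact mem_iUnion.2 ⟨i, x, hx, rfl⟩

theorem IsConformalIFS.exists_isDerivCocycle {d : ℕ} {ι : Type*} [Finite ι] [Nontrivial (E d)]
    {Φ : ι → E d → E d} {Y X : Set (E d)} (hΦ : IsConformalIFS Φ Y) (hX : IsAttractor Φ Y X) :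
    ∃ C : WeightCocycle ι X, IsDerivCocycle Φ X C := by
  obtain ⟨happ, K, a, b, hK, ha0, ha1, hb0, hb1, h⟩ := hΦ.exists_bounds
  have hXY := hX.subset
  have hmaps := mapsTo_wordMap hX.mapsTo
  exact ⟨{
    act := fun I x => ⟨wordMap Φ I x, hmaps I x.2⟩
    weight := fun I x => ‖fderiv ℝ (wordMap Φ I) x‖
    weight_append := fun I J x => happ I J x (hXY x.2)
    K := K
    a := a
    b := b
    one_le_K := hK
    a_pos := ha0
    a_lt_one := ha1
    b_pos := hb0
    b_lt_one := hb1
    pow_le_weight := fun I x => (h I x (hXY x.2)).1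
    weight_le_pow := fun I x => (h I x (hXY x.2)).2.1
    distortion := fun I x y => ((h I x (hXY x.2)).2.2 y (hXY y.2)).1 },
    fun _ _ => rfl, fun _ _ => rfl, fun I x y => ((h I x (hXY x.2)).2.2 y (hXY y.2)).2.1,
    fun I x y => ((h I x (hXY x.2)).2.2 y (hXY y.2)).2.2⟩

section Dimension

variable {d : ℕ} {ι : Type*} {Φ : ι → E d → E d} {Y X : Set (E d)}
  {C : WeightCocycle ι X}

theorem IsDerivCocycle.diam_image_le (hC : IsDerivCocycle Φ X C) {D : ℝ}
    (hD : ∀ x ∈ X, ∀ y ∈ X, ‖x - y‖ ≤ D) (I : List ι) (z : X) :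
    Metric.diam (wordMap Φ I '' X) ≤ C.K ^ 2 * D * C.weight I z := by
  have hD0 : 0 ≤ D := (norm_nonneg _).trans (hD z z.2 z z.2)
  have hK := C.K_pos
  have hz := C.weight_pos I z
  refine Metric.diam_le_of_forall_dist_le (by positivity) ?_
  rintro _ ⟨x, hx, rfl⟩ _ ⟨y, hy, rfl⟩
  rw [dist_eq_norm]
  calc _ ≤ C.K * (C.weight I ⟨x, hx⟩ * ‖x - y‖) := hC.norm_sub_le I ⟨x, hx⟩ ⟨y, hy⟩
    _ ≤ C.K * ((C.K * C.weight I z) * D) := by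
        gcongr
        · exact C.distortion I _ z
        · exact hD x hx y hy
    _ = _ := by ring

/-- If the block `J` can be replaced by `J'`, then every word acts on `Y` like a word which is a
concatenation of blocks different from `J`, followed by a word shorter than a block. -/
theorem exists_flatMap_append_eqOn (hmaps : ∀ i, MapsTo (Φ i) Y Y) {N : ℕ} (hN : N ≠ 0)
    {J J' : Fin N → ι} (hne : J' ≠ J)
    (hJ : EqOn (wordMap Φ (List.ofFn J)) (wordMap Φ (List.ofFn J')) Y) (I : List ι) :
    ∃ (L : List {A : Fin N → ι // A ≠ J}) (Q : List ι), Q.length < N ∧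
      (L.flatMap (fun A => List.ofFn A.1) ++ Q).length = I.length ∧
      EqOn (wordMap Φ I) (wordMap Φ (L.flatMap (fun A => List.ofFn A.1) ++ Q)) Y := by
  induction hn : I.length using Nat.strong_induction_on generalizing I with
  | _ n ih =>
    rcases lt_or_ge n N with hlt | hge
    · exact ⟨[], I, hn ▸ hlt, by simpa using hn, by simp [EqOn]⟩
    · have hlen : (I.drop N).length = n - N := by rw [List.length_drop, hn]
      obtain ⟨L, Q, hQ, hLQ, heq⟩ := ih (n - N) (by omega) (I.drop N) hlen
      have htake : (I.take N).length = N := by rw [List.length_take]; omega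
      obtain ⟨A, hA⟩ : ∃ A : Fin N → ι, List.ofFn A = I.take N :=
        ⟨fun i => (I.take N).get (i.cast htake.symm), by
          apply List.ext_get <;> simp [hn, hge]⟩
      -- The substitution happens in the outermost block, which is evaluated at points of `Y` only.
      obtain ⟨B, hB, hAB⟩ : ∃ B : Fin N → ι, B ≠ J ∧
          EqOn (wordMap Φ (List.ofFn A)) (wordMap Φ (List.ofFn B)) Y := by
        by_cases h : A = J
        · exact ⟨J', hne, h ▸ hJ⟩
        · exact ⟨A, h, fun _ _ => rfl⟩
      refine ⟨⟨B, hB⟩ :: L, Q, hQ, ?_, fun x hx => ?_⟩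
      · rw [List.length_append] at hLQ
        simp only [List.flatMap_cons, List.length_append, List.length_ofFn]
        omega
      · have hY := mapsTo_wordMap hmaps (I.drop N) hx
        rw [List.flatMap_cons, List.append_assoc, wordMap_append, ← heq hx, ← hAB hY, hA,
          ← wordMap_append, List.take_append_drop]

variable [Fintype ι]

theorem IsDerivCocycle.derivSum_eq (hC : IsDerivCocycle Φ X C) (s : ℝ) (n : ℕ) (x : X) :
    derivSum Φ s n x = C.weightSum s n x := by
  simp only [derivSum, WeightCocycle.weightSum, hC.weight_eq]

/-- By bounded distortion the infimum and the supremum are comparable to the value at any single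
point, so both limits always exist and agree. -/
theorem IsDerivCocycle.hasPressure_iff (hC : IsDerivCocycle Φ X C) [Nonempty ι] (x : X) (s p : ℝ) :
    HasPressure Φ X s p ↔ C.pressure x s = p := by
  have : Nonempty X := ⟨x⟩
  have hK : 0 < C.K ^ |s| := Real.rpow_pos_of_pos C.K_pos _
  have hle : ∀ n (y y' : X), derivSum Φ s n y ≤ C.K ^ |s| * derivSum Φ s n y' := fun n y y' => by
    rw [hC.derivSum_eq, hC.derivSum_eq]
    exact C.weightSum_le s n y y'
  have hnn : ∀ n (y : X), 0 ≤ derivSum Φ s n y := fun n y => by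
    rw [hC.derivSum_eq]
    exact C.weightSum_nonneg s n y
  have hbelow : ∀ n, BddBelow (range fun y : X => derivSum Φ s n y) := fun n =>
    ⟨0, by rintro _ ⟨y, rfl⟩; exact hnn n y⟩
  have habove : ∀ n, BddAbove (range fun y : X => derivSum Φ s n y) := fun n =>
    ⟨C.K ^ |s| * derivSum Φ s n x, by rintro _ ⟨y, rfl⟩; exact hle n y x⟩
  have hone : ∀ n, derivSum Φ s n x ≤ C.K ^ |s| * derivSum Φ s n x := fun n =>
    le_mul_of_one_le_left (hnn n x) (Real.one_le_rpow C.one_le_K (abs_nonneg s))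
  have h1 : Tendsto (fun n : ℕ => (1 / (n : ℝ)) * Real.log (⨅ y : X, derivSum Φ s n y)) atTop
      (𝓝 (C.pressure x s)) := by
    refine C.tendsto_log_of_comparable x s hK (fun n => ?_) fun n => ?_
    · rw [← hC.derivSum_eq]
      exact (ciInf_le (hbelow n) x).trans (hone n)
    · rw [← hC.derivSum_eq, Real.mul_iInf_of_nonneg hK.le]
      exact le_ciInf fun y => hle n x y
  have h2 : Tendsto (fun n : ℕ => (1 / (n : ℝ)) * Real.log (⨆ y : X, derivSum Φ s n y)) atTop
      (𝓝 (C.pressure x s)) := by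
    refine C.tendsto_log_of_comparable x s hK (fun n => ?_) fun n => ?_
    · rw [← hC.derivSum_eq]
      exact ciSup_le fun y => hle n y x
    · rw [← hC.derivSum_eq]
      exact (hone n).trans (mul_le_mul_of_nonneg_left (le_ciSup (habove n) x) hK.le)
  exact ⟨fun h => tendsto_nhds_unique h1 h.1, fun h => ⟨h ▸ h1, h ▸ h2⟩⟩

theorem IsDerivCocycle.existsUnique_hasPressure_zero (hC : IsDerivCocycle Φ X C) [Nontrivial ι]
    (x : X) : ∃! s : ℝ, HasPressure Φ X s 0 := by
  obtain ⟨s, -, hs⟩ := C.exists_pressure_eq_zero x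
  refine ⟨s, (hC.hasPressure_iff x s 0).2 hs, fun t ht => ?_⟩
  exact (C.strictAnti_pressure x).injective (((hC.hasPressure_iff x t 0).1 ht).trans hs.symm)

theorem IsDerivCocycle.simDim_pos_and_pressure (hC : IsDerivCocycle Φ X C) [Nontrivial ι] (x : X) :
    0 < simDim Φ X ∧ ∀ y, C.pressure y (simDim Φ X) = 0 := by
  obtain ⟨s, hs0, hs⟩ := C.exists_pressure_eq_zero x
  have h : {s : ℝ | HasPressure Φ X s 0} = {s} := by
    ext t
    rw [mem_ofPred_eq, hC.hasPressure_iff x, mem_singleton_iff]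
    exact ⟨fun ht => (C.strictAnti_pressure x).injective (ht.trans hs.symm), fun ht => ht ▸ hs⟩
  have h2 : simDim Φ X = s := by rw [simDim, h, csInf_singleton]
  rw [h2]
  exact ⟨hs0, fun y => (C.pressure_eq y x s).trans hs⟩

/-- The exponents cancel to `diam ^ s`. Two distinct points of `X` bound each diameter below by a
multiple of the weight, so every level sum exceeds the same positive constant. -/
theorem IsDerivCocycle.diverges_one (hC : IsDerivCocycle Φ X C) [Nontrivial ι]
    (hXc : IsCompact X) (hX : X.Nontrivial) (hδ : 0 < hdim X) : Diverges Φ X fun _ => 1 := by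
  obtain ⟨x, hx, y, hy, hxy⟩ := hX
  obtain ⟨hs, hp⟩ := hC.simDim_pos_and_pressure ⟨x, hx⟩
  set s := simDim Φ X with hsdef
  have hK := C.K_pos
  have hnorm : 0 < ‖x - y‖ := norm_pos_iff.2 (sub_ne_zero.2 hxy)
  have hcomp : ∀ I : List ι, (‖x - y‖ / C.K) ^ s * C.weight I ⟨x, hx⟩ ^ s
      ≤ approxFun Φ X (fun _ => 1) I ^ hdim X := by
    intro I
    have hw := C.weight_pos I ⟨x, hx⟩
    -- Boundedness matters: `Metric.diam` is `0` on unbounded sets.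
    have hcont : IsCompact (wordMap Φ I '' X) := by
      refine hXc.image_of_continuousOn (LipschitzOnWith.continuousOn (K := ⟨C.K, hK.le⟩) ?_)
      refine LipschitzOnWith.of_dist_le_mul fun u hu v hv => ?_
      rw [dist_eq_norm, dist_eq_norm]
      refine (hC.norm_sub_le I ⟨u, hu⟩ ⟨v, hv⟩).trans ?_
      exact mul_le_mul_of_nonneg_left
        (mul_le_of_le_one_left (norm_nonneg _) (C.weight_le_one _ _)) hK.le
    have h1 : ‖x - y‖ / C.K * C.weight I ⟨x, hx⟩ ≤ Metric.diam (wordMap Φ I '' X) := by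
      have h2 := Metric.dist_le_diam_of_mem hcont.isBounded (mem_image_of_mem _ hx)
        (mem_image_of_mem (wordMap Φ I) hy)
      refine le_trans ?_ h2
      rw [div_mul_eq_mul_div, div_le_iff₀' hK, dist_eq_norm, mul_comm]
      exact hC.le_norm_sub I ⟨x, hx⟩ ⟨y, hy⟩
    rw [approxFun, NNReal.coe_one, mul_one, ← Real.rpow_mul Metric.diam_nonneg,
      div_mul_cancel₀ _ hδ.ne', ← Real.mul_rpow (by positivity) hw.le]
    exact Real.rpow_le_rpow (by positivity) h1 hs.le
  set c := (‖x - y‖ / C.K) ^ s * (C.K ^ |s|)⁻¹ with hc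
  have hc0 : 0 < c := by positivity
  rw [Diverges, eq_top_iff, ← ENNReal.tsum_const_eq_top_of_ne_zero (α := ℕ)
    (ENNReal.ofReal_pos.2 hc0).ne']
  refine ENNReal.tsum_le_tsum fun n => ?_
  have hnn : ∀ I : Fin (n + 1) → ι,
      0 ≤ approxFun Φ X (fun _ => 1) (List.ofFn I) ^ hdim X := fun I =>
    (mul_nonneg (by positivity) (Real.rpow_nonneg (C.weight_pos _ _).le _)).trans (hcomp _)
  rw [← ENNReal.ofReal_sum_of_nonneg fun I _ => hnn I]
  refine ENNReal.ofReal_le_ofReal ?_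
  calc c ≤ (‖x - y‖ / C.K) ^ s * C.weightSum s (n + 1) ⟨x, hx⟩ := by
        rw [hc]
        gcongr
        rw [inv_le_iff_one_le_mul₀' (by positivity)]
        exact C.one_le_weightSum_of_pressure_eq_zero (hp _) _
    _ ≤ _ := by
        rw [WeightCocycle.weightSum, Finset.mul_sum]
        exact Finset.sum_le_sum fun I _ => hcomp _

end Dimension

/-! ### Dimension of the limsup set -/

section LimsupSet

variable {d : ℕ} {ι : Type*} [Fintype ι] {Φ : ι → E d → E d} {Y X : Set (E d)}
  {C : WeightCocycle ι X}

/-- A bound uniform in `n` suffices; the sums need not tend to zero, since finite Hausdorff measure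
already bounds the dimension. -/
theorem _root_.dimH_le_of_tsum_ediam_rpow_le {Z β : Type*} [EMetricSpace Z] [Countable β]
    {A : Set Z} {t : ℝ} (ht : 0 ≤ t) {cover : ℕ → β → Set Z} {r : ℕ → ℝ≥0∞} {S : ℝ≥0∞}
    (hS : S ≠ ⊤) (hr : Tendsto r atTop (𝓝 0)) (hcover : ∀ n, A ⊆ ⋃ p, cover n p)
    (hdiam : ∀ n p, Metric.ediam (cover n p) ≤ r n)
    (hsum : ∀ n, ∑' p, Metric.ediam (cover n p) ^ t ≤ S) : dimH A ≤ ENNReal.ofReal t := by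
  borelize Z
  refine dimH_le_of_hausdorffMeasure_ne_top (d := t.toNNReal) (ne_top_of_le_ne_top hS ?_)
  rw [Real.coe_toNNReal t ht]
  refine (Measure.hausdorffMeasure_le_liminf_tsum t A r hr cover
    (Eventually.of_forall hdiam) (Eventually.of_forall hcover)).trans ?_
  exact liminf_le_of_frequently_le' (Frequently.of_forall hsum)

theorem IsDerivCocycle.dimH_limsupSet_le (hC : IsDerivCocycle Φ X C)
    (hmaps : ∀ i, MapsTo (Φ i) Y Y) (hXY : X ⊆ Y) (hXc : IsCompact X)
    {N : ℕ} (hN : N ≠ 0) {J J' : Fin N → ι} (hJJ' : J' ≠ J)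
    (heq : EqOn (wordMap Φ (List.ofFn J)) (wordMap Φ (List.ofFn J')) Y) (hδ : 0 < hdim X)
    (hs : 0 < simDim Φ X) [DecidableEq ι] {τ M : ℝ} (hτ0 : 0 < τ)
    (hM : ∀ n x, ∑ j ∈ Finset.range n, (C.removeBlock J hN).weightSum τ j x ≤ M)
    {z : E d} (hz : z ∈ X) :
    dimH (limsupSet Φ X (approxFun Φ X fun _ => 1) z)
      ≤ ENNReal.ofReal (τ * hdim X / simDim Φ X) := by
  set s := simDim Φ X with hsdef
  set δ := hdim X with hδdef
  -- Chosen so that radii `diam ^ (s / δ)` raised to the power `t` become `diam ^ τ`.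
  set t : ℝ := τ * δ / s with ht
  have ht0 : 0 < t := by positivity
  obtain ⟨D, hD0, hD⟩ : ∃ D : ℝ, 0 ≤ D ∧ ∀ x ∈ X, ∀ y ∈ X, ‖x - y‖ ≤ D := by
    obtain ⟨D, hD⟩ := Metric.isBounded_iff.1 hXc.isBounded
    exact ⟨|D|, abs_nonneg D, fun x hx y hy =>
      (by simpa [dist_eq_norm] using hD hx hy : ‖x - y‖ ≤ D).trans (le_abs_self D)⟩
  set R := C.K ^ 2 * D with hR
  have hR0 : 0 ≤ R := by positivity
  have hdiam := hC.diam_image_le hD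
  have : Finite {Q : List ι // Q.length < N} := (List.finite_length_lt ι N).to_subtype
  have : Fintype {Q : List ι // Q.length < N} := Fintype.ofFinite _
  set word : List {A : Fin N → ι // A ≠ J} × {Q : List ι // Q.length < N} → List ι :=
    fun p => p.1.flatMap (fun A => List.ofFn A.1) ++ p.2 with hword
  set ρ : List ι → ℝ := fun I => Metric.diam (wordMap Φ I '' X) ^ (s / δ) with hρ
  have hρ0 : ∀ I, 0 ≤ ρ I := fun I => Real.rpow_nonneg Metric.diam_nonneg _
  -- Short words receive the empty set, so the mesh tends to zero over a fixed index type.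
  set cover : ℕ → List {A : Fin N → ι // A ≠ J} × {Q : List ι // Q.length < N} → Set (E d) :=
    fun n p => if n ≤ (word p).length then
      Metric.closedBall (wordMap Φ (word p) z) (ρ (word p)) else ∅ with hcover
  have hsub : ∀ n, limsupSet Φ X (approxFun Φ X fun _ => 1) z ⊆ ⋃ p, cover n p := by
    rintro n x ⟨-, hx⟩
    -- The finite alphabet has only finitely many words shorter than `n`, so a longer one is
    -- available.
    obtain ⟨I, ⟨-, hI⟩, hIn⟩ := (hx.sdiff (List.finite_length_lt ι n)).nonempty
    obtain ⟨L, Q, hQ, hLQ, hEq⟩ := exists_flatMap_append_eqOn hmaps hN hJJ' heq I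
    refine mem_iUnion.2 ⟨(L, ⟨Q, hQ⟩), ?_⟩
    have hIn' : n ≤ (word (L, ⟨Q, hQ⟩)).length := by
      simp only [hword, hLQ]
      exact not_lt.1 hIn
    simp only [hcover, if_pos hIn', hρ]
    simp only [hword]
    rw [← hEq (hXY hz), ← (hEq.mono hXY).image_eq]
    simpa [approxFun] using hI
  have hediam : ∀ n p, Metric.ediam (cover n p) ≤ ENNReal.ofReal (2 * ρ (word p)) := by
    intro n p
    simp only [hcover]
    split_ifs
    · refine Metric.ediam_le_of_forall_dist_le fun x hx y hy => ?_
      have := dist_triangle_right x y (wordMap Φ (word p) z)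
      linarith [Metric.mem_closedBall.1 hx, Metric.mem_closedBall.1 hy]
    · simp
  have hb0 := C.b_pos
  have hsδ : 0 < s / δ := by positivity
  have hmesh : Tendsto (fun n : ℕ => ENNReal.ofReal (2 * (R * C.b ^ n) ^ (s / δ))) atTop (𝓝 0) := by
    rw [← ENNReal.ofReal_zero]
    refine ENNReal.tendsto_ofReal ?_
    have h1 := ((tendsto_pow_atTop_nhds_zero_of_lt_one hb0.le C.b_lt_one).const_mul R).rpow_const
      (p := s / δ) (Or.inr hsδ.le)
    rw [mul_zero, Real.zero_rpow hsδ.ne'] at h1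
    simpa using h1.const_mul 2
  have hmesh_le : ∀ n p, Metric.ediam (cover n p)
      ≤ ENNReal.ofReal (2 * (R * C.b ^ n) ^ (s / δ)) := by
    intro n p
    by_cases hn : n ≤ (word p).length
    · refine (hediam n p).trans (ENNReal.ofReal_le_ofReal ?_)
      refine mul_le_mul_of_nonneg_left ?_ zero_le_two
      refine Real.rpow_le_rpow Metric.diam_nonneg ((hdiam _ ⟨z, hz⟩).trans ?_) hsδ.le
      refine mul_le_mul_of_nonneg_left ((C.weight_le_pow _ _).trans ?_) hR0
      exact pow_le_pow_of_le_one hb0.le C.b_lt_one.le hn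
    · simp [hcover, hn]
  have hpow : ∀ n p, Metric.ediam (cover n p) ^ t ≤ ENNReal.ofReal (2 ^ t * R ^ τ) *
      ENNReal.ofReal ((C.removeBlock J hN).weight p.1 (C.act p.2 ⟨z, hz⟩) ^ τ) := by
    intro n p
    -- The weight of the remainder is dropped, as there are only finitely many remainders. The base
    -- point becomes the image of `z` under the remainder, which is why `M` must be uniform in the
    -- point.
    have hw : C.weight (word p) ⟨z, hz⟩
        ≤ (C.removeBlock J hN).weight p.1 (C.act p.2 ⟨z, hz⟩) := by
      simp only [hword]
      rw [C.weight_append]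
      exact mul_le_of_le_one_right (C.weight_pos _ _).le (C.weight_le_one _ _)
    have hw0 := (C.removeBlock J hN).weight_pos p.1 (C.act p.2 ⟨z, hz⟩)
    calc _ ≤ ENNReal.ofReal (2 * ρ (word p)) ^ t := ENNReal.rpow_le_rpow (hediam n p) ht0.le
      _ = ENNReal.ofReal ((2 * ρ (word p)) ^ t) :=
          ENNReal.ofReal_rpow_of_nonneg (mul_nonneg zero_le_two (hρ0 _)) ht0.le
      _ = ENNReal.ofReal (2 ^ t * Metric.diam (wordMap Φ (word p) '' X) ^ τ) := by
          rw [Real.mul_rpow zero_le_two (hρ0 _), hρ, ← Real.rpow_mul Metric.diam_nonneg]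
          congr 3
          rw [ht]
          field_simp
      _ ≤ ENNReal.ofReal (2 ^ t * (R ^ τ *
            (C.removeBlock J hN).weight p.1 (C.act p.2 ⟨z, hz⟩) ^ τ)) := by
          rw [← Real.mul_rpow hR0 hw0.le]
          refine ENNReal.ofReal_le_ofReal (mul_le_mul_of_nonneg_left ?_ (by positivity))
          refine Real.rpow_le_rpow Metric.diam_nonneg ((hdiam _ ⟨z, hz⟩).trans ?_) hτ0.le
          exact mul_le_mul_of_nonneg_left hw hR0
      _ = _ := by rw [← mul_assoc, ENNReal.ofReal_mul (by positivity)]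
  set S : ℝ≥0∞ := ENNReal.ofReal (2 ^ t * R ^ τ) *
    ∑ _Q : {Q : List ι // Q.length < N}, ENNReal.ofReal M with hSdef
  have hS : S ≠ ⊤ := ENNReal.mul_ne_top ENNReal.ofReal_ne_top
    (ENNReal.sum_ne_top.2 fun _ _ => ENNReal.ofReal_ne_top)
  have htsum : ∀ n, ∑' p, Metric.ediam (cover n p) ^ t ≤ S := by
    intro n
    refine (ENNReal.tsum_le_tsum (hpow n)).trans ?_
    rw [ENNReal.tsum_mul_left, hSdef]
    gcongr
    rw [ENNReal.tsum_prod (f := fun (L : List {A : Fin N → ι // A ≠ J})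
      (Q : {Q : List ι // Q.length < N}) =>
        ENNReal.ofReal ((C.removeBlock J hN).weight L (C.act Q ⟨z, hz⟩) ^ τ)),
      ENNReal.tsum_comm, tsum_fintype]
    refine Finset.sum_le_sum fun Q _ => ?_
    rw [WeightCocycle.tsum_weight_rpow]
    refine ENNReal.tsum_le_of_sum_range_le fun k => ?_
    rw [← ENNReal.ofReal_sum_of_nonneg fun j _ => WeightCocycle.weightSum_nonneg _ _ _ _]
    exact ENNReal.ofReal_le_ofReal (hM k _)
  exact dimH_le_of_tsum_ediam_rpow_le ht0.le hS hmesh hsub hmesh_le htsum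

theorem IsDerivCocycle.dimH_limsupSet_lt (hC : IsDerivCocycle Φ X C) [Nontrivial ι]
    (hmaps : ∀ i, MapsTo (Φ i) Y Y) (hXY : X ⊆ Y) (hXc : IsCompact X)
    (hover : HasExactOverlap Φ Y) (hδ : 0 < hdim X) {z : E d} (hz : z ∈ X) :
    dimH (limsupSet Φ X (approxFun Φ X fun _ => 1) z) < ENNReal.ofReal (hdim X) := by
  classical
  obtain ⟨J₀, J₀', hlen, hne, heq⟩ := hover
  set N := J₀.length with hNdef
  have hN : N ≠ 0 := by
    intro h0
    rw [h0] at hlen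
    exact hne ((List.eq_nil_of_length_eq_zero h0).trans
      (List.eq_nil_of_length_eq_zero hlen.symm).symm)
  obtain ⟨J, hJ⟩ : ∃ J : Fin N → ι, List.ofFn J = J₀ := ⟨J₀.get, List.ofFn_get J₀⟩
  obtain ⟨J', hJ'⟩ : ∃ J : Fin N → ι, List.ofFn J = J₀' :=
    ⟨fun i => J₀'.get (i.cast hlen), by apply List.ext_get <;> simp [hlen]⟩
  have hJJ' : J' ≠ J := by
    rintro rfl
    exact hne (hJ.symm.trans hJ')
  rw [← hJ, ← hJ'] at heq
  have : Nonempty X := ⟨⟨z, hz⟩⟩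
  obtain ⟨hs, hp⟩ := hC.simDim_pos_and_pressure ⟨z, hz⟩
  obtain ⟨τ, hτ0, hτs, M, hM⟩ := C.exists_lt_sum_range_removeBlock_le J hN hs hp
  refine (hC.dimH_limsupSet_le hmaps hXY hXc hN hJJ' heq hδ hs hτ0 hM hz).trans_lt ?_
  rw [ENNReal.ofReal_lt_ofReal_iff hδ, div_lt_iff₀ hs, mul_comm]
  exact mul_lt_mul_of_pos_left hτs hδ

/-- If `X` is null at its dimension, regularity contradicts the dimension drop directly. Otherwise
the limsup set is null and cannot contain almost every point of `X`. -/
theorem not_isApproxRegularPair_of_dimH_lt (hX : IsCompact X)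
    (hdim_eq : ENNReal.ofReal (hdim X) = dimH X)
    (hdiv : Diverges Φ X fun _ => 1) {z : E d}
    (hlt : z ∈ X → dimH (limsupSet Φ X (approxFun Φ X fun _ => 1) z) < dimH X) :
    ¬ IsApproxRegularPair Φ X z := by
  rintro ⟨hz, hpos, hzero⟩
  have hanti : AntitoneOn (fun _ : ℕ => (1 : ℝ≥0)) (Ici 1) := fun _ _ _ _ _ => le_rfl
  rcases eq_or_ne (Measure.hausdorffMeasure (hdim X) X) 0 with h0 | h0
  · exact (hlt hz).ne (hzero h0 _ hanti hdiv)
  · have hae := hpos (pos_iff_ne_zero.2 h0) _ hanti hdiv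
    have hlt' : dimH (limsupSet Φ X (approxFun Φ X fun _ => 1) z) < ((hdim X).toNNReal : ℝ≥0) := by
      have := hlt hz
      rwa [← hdim_eq] at this
    have hW := hausdorffMeasure_of_dimH_lt hlt'
    rw [Real.coe_toNNReal (hdim X) ENNReal.toReal_nonneg] at hW
    rw [ae_restrict_iff' hX.measurableSet, ae_iff] at hae
    refine h0 (measure_mono_null (fun x hx => ?_) (measure_union_null hW hae))
    by_cases h : x ∈ limsupSet Φ X (approxFun Φ X fun _ => 1) z
    · exact Or.inl h
    · exact Or.inr fun h' => h (h' hx)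

end LimsupSet

/-- Over at most one letter, words of equal length coincide. Two letters are what makes the pressure
positive at `0`. -/
theorem HasExactOverlap.nontrivial {d : ℕ} {ι : Type*} {Φ : ι → E d → E d} {Y : Set (E d)}
    (h : HasExactOverlap Φ Y) : Nontrivial ι := by
  obtain ⟨I, J, hlen, hne, -⟩ := h
  by_contra hn
  rw [not_nontrivial_iff_subsingleton] at hn
  exact hne (List.ext_getElem hlen fun _ _ _ => Subsingleton.elim _ _)

end ConformalIFS

theorem mainTheorem10 {d : ℕ} {ι : Type*} [Fintype ι]
    (Φ : ι → ConformalIFS.E d → ConformalIFS.E d) (Y X : Set (ConformalIFS.E d))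
    (hΦ : ConformalIFS.IsConformalIFS Φ Y)
    (hX : ConformalIFS.IsAttractor Φ Y X)
    (hpos : 0 < dimH X)
    (hover : ConformalIFS.HasExactOverlap Φ Y) :
    -- the similarity dimension is well defined
    (∃! s : ℝ, ConformalIFS.HasPressure Φ X s 0) ∧
    -- there are no approximation regular pairs
    (∀ z, ¬ ConformalIFS.IsApproxRegularPair Φ X z) ∧
    -- for `θ ≡ 1` the sum diverges, but the limsup set has smaller dimension
    ConformalIFS.Diverges Φ X (fun _ => 1) ∧
    (∀ z ∈ X, dimH (ConformalIFS.limsupSet Φ X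
      (ConformalIFS.approxFun Φ X (fun _ => 1)) z) < dimH X) := by
  -- Positive dimension supplies two distinct points: they bound diameters from below and exclude `d
  -- = 0`, where the identity would have norm `0`.
  have hXnt : X.Nontrivial := by
    by_contra h
    rw [not_nontrivial_iff] at h
    exact hpos.ne' (dimH_subsingleton h)
  have hEnt : Nontrivial (ConformalIFS.E d) := by
    obtain ⟨x, -, y, -, hxy⟩ := hXnt
    exact ⟨x, y, hxy⟩
  have hιnt := hover.nontrivial
  have htop : dimH X ≠ ⊤ := by
    refine ne_top_of_le_ne_top ?_ (dimH_mono (subset_univ X))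
    rw [Real.dimH_univ_eq_finrank]
    exact ENNReal.natCast_ne_top _
  have hdim_eq : ENNReal.ofReal (ConformalIFS.hdim X) = dimH X := ENNReal.ofReal_toReal htop
  have hδ : 0 < ConformalIFS.hdim X := ENNReal.toReal_pos hpos.ne' htop
  obtain ⟨x, hx⟩ := hX.nonempty
  obtain ⟨C, hC⟩ := hΦ.exists_isDerivCocycle hX
  have hdiv := hC.diverges_one hX.isCompact hXnt hδ
  have hlt : ∀ z ∈ X, dimH (ConformalIFS.limsupSet Φ X
      (ConformalIFS.approxFun Φ X (fun _ => 1)) z) < dimH X := fun z hz => by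
    rw [← hdim_eq]
    exact hC.dimH_limsupSet_lt hΦ.mapsTo hX.subset hX.isCompact hover hδ hz
  exact ⟨hC.existsUnique_hasPressure_zero ⟨x, hx⟩, fun z =>
    ConformalIFS.not_isApproxRegularPair_of_dimH_lt hX.isCompact hdim_eq hdiv (hlt z), hdiv, hlt⟩
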